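/- Let $g(u):=2u\ln u+2(1-u)\ln(1-u)+1$ for $0\le u\le 1$ (with $0\ln 0:=0$). For a probability distribution $G=\mathcal L(V)$ on $\mathbb R$ let $SG:=\mathcal L(UV+(1-U)V^*+g(U))$, where $U,V,V^*$ are independent, $U$ is uniform on $(0,1)$ and $V^*$ has the same law as $V$. There is exactly one law with mean $0$ and finite variance that is fixed by $S$, the limiting Quicksort law $F=\mathcal L(Y)$; its variance is $\sigma^2:=\operatorname{Var}Y=7-\tfrac23\pi^2$, and it has a bounded, infinitely differentiable density $f$. For a real random variable $Z_0$ let $Z_n$ denote a random variable with law $S^n\mathcal L(Z_0)$, and let $\phi_{Z_n}(t)=\mathbf E\,e^{itZ_n}$. For every real $p>1$ there is a constant $0<c_p<\infty$ such that for every random variable $Z_0$, every integer $n>p+1$ and every real $t\ne0$, $$|\phi_{Z_n}(t)|\le c_p|t|^{-p}. \tag{1}$$ **Theorem 3.2.** Suppose that $\mathbf E Z_0=0$ and $\operatorname{Var}Z_0<\infty$, and let $A:=(\operatorname{Var}Z_0+\sigma^2)^{1/2}$. Then for every $n\ge3$ the random variable $Z_n$ has a bounded continuous density $f_n$, and the $f_n$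 converge uniformly to $f$ at a geometric rate: for every fixed $r>(2/3)^{1/2}$, $$\sup_x|f_n(x)-f(x)|=O(r^n).$$ Explicitly, for any real $p>1$, any constant $c_p>0$ satisfying (1) (for all $Z_0$, all $n>p+1$ and all $t\neq 0$), and any integer $n>p+1$, $$\sup_x|f_n(x)-f(x)|\le\frac{A}{2\pi}\Bigl(\frac{2c_p}{A}\Bigr)^{2/(p+1)}\frac{p+1}{p-1}\Bigl(\frac23\Bigr)^{\left(\frac12-\frac1{p+1}\right)n}.$$ In particular, $$\sup_x|f_n(x)-f(x)|\le2297\,A\Bigl(\frac23\Bigr)^{5n/18}<2297\,A\,(0.8935)^n,\qquad n\ge5.$$ Moreover, $$\sup_x|f_n(x)-f(x)|\le\frac{128A}{\pi}\Bigl(\frac23\Bigr)^{(n/2)-3.7\sqrt n},\qquad n\ge3.$$ -/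

import Mathlib

open MeasureTheory ProbabilityTheory
open scoped ContDiff

/-- The function `g(u) = 2u ln u + 2(1-u) ln(1-u) + 1` on `[0,1]` (with `0 ln 0 = 0`). -/
noncomputable def quicksortG (u : ℝ) : ℝ :=
  2 * u * Real.log u + 2 * (1 - u) * Real.log (1 - u) + 1

/-- Rösler's operator `S`: it maps the law `μ` of `V` to the law of `U V + (1 - U) V* + g(U)`,
where `U`, `V`, `V*` are independent, `U` is uniform on `[0,1]` and `V*` has the law of `V`. -/
noncomputable def quicksortS (μ : Measure ℝ) : Measure ℝ :=
  ((volume.restrict (Set.Icc (0 : ℝ) 1)).prod (μ.prod μ)).map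
    (fun w : ℝ × ℝ × ℝ => w.1 * w.2.1 + (1 - w.1) * w.2.2 + quicksortG w.1)

/-- `ν` is a probability law with mean `0` and finite variance that is fixed by `S`. The limiting Quicksort
law `L(Y)` is the only such law. -/
structure IsQuicksortLaw (ν : Measure ℝ) : Prop where
  isProbabilityMeasure : IsProbabilityMeasure ν
  memLp_two : MemLp (fun x : ℝ => x) 2 ν
  mean_zero : ∫ x, x ∂ν = 0
  fixed : quicksortS ν = ν

/-- `f` is a bounded continuous (nonnegative) density of `μ` with respect to Lebesgue measure.
There is at most one such function. -/
structure IsBddContDensity (μ : Measure ℝ) (f : ℝ → ℝ) : Prop where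
  continuous : Continuous f
  nonneg : ∀ x, 0 ≤ f x
  bounded : ∃ C : ℝ, ∀ x, f x ≤ C
  eq_withDensity : μ = volume.withDensity (fun x => ENNReal.ofReal (f x))

/-- `c` is a valid constant `c_p` in the bound `|φ_{Z_n}(t)| ≤ c_p |t|^{-p}`, uniformly over all
starting laws `L(Z_0)` (no moment assumption), all `n > p + 1` and all real `t ≠ 0`; here
`L(Z_n) = S^n L(Z_0)`. -/
def IsCharFunConst (p c : ℝ) : Prop :=
  0 < c ∧ ∀ μ : Measure ℝ, IsProbabilityMeasure μ → ∀ n : ℕ, p + 1 < (n : ℝ) →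
    ∀ t : ℝ, t ≠ 0 → ‖charFun (quicksortS^[n] μ) t‖ ≤ c * |t| ^ (-p)

/-- `A = (Var Z_0 + Var Y)^{1/2}` for `Z_0` with law `μ` and `Y` with law `ν`. -/
noncomputable def quicksortA (μ ν : Measure ℝ) : ℝ :=
  √(variance (fun x : ℝ => x) μ + variance (fun x : ℝ => x) ν)

/-! Write φ_μ for the characteristic function. Conditioning on U gives φ_{Sμ}(t) = ∫₀¹ φ_μ(ut)
φ_μ((1-u)t) e^{itg(u)} du. Two consequences of this formula are played against each other.

Smoothing. Given V and V*, the exponent is t(au + g(u)) up to a constant, and g'' = 2/u + 2/(1-u) ≥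
8, so van der Corput's lemma bounds |φ_{Sμ}(t)| by 2t^(-1/2) for every μ whatsoever. Feeding a decay
rate back into the formula improves it: the exponents run 1/2, 1, 3/2 and then grow by 1 at each
application of S, with constants that do not depend on μ. This yields the c_p
(`exists_isCharFunConst`) and the explicit constants (`uniformCharFunDecay_three_half`,
`uniformCharFunDecay_seven_half`, `uniformCharFunDecay_decayConst`).

Contraction. S contracts the distance sup |φ_μ - φ_ν|/t² by E[U² + (1-U)²] = 2/3
(`norm_charFun_quicksortS_sub_le`). For mean-zero laws of finite variance this distance is finite,
which gives existence and uniqueness of the fixed law. Interpolated with the trivial bound 2, it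
gives |φ_{Z_n}(t) - φ_Y(t)| ≤ A (2/3)^(n/2) |t|.

By Fourier inversion, sup |f_n - f| is at most 1/(2π) times the integral of |φ_{Z_n} - φ_Y|. The
contraction bound is used for small |t| and the decay bound 2c_p|t|^(-p) for large |t|; cutting
where they agree gives the general estimate (`abs_charFunDensity_iterate_sub_le`). The other
estimates come from p = 7/2, from p = 3/2, from p close to 0.54√n, and from p fixed but large. -/

/-! ### Van der Corput estimates -/

/-- First derivative test for oscillatory integrals with a convex phase. -/
theorem norm_integral_exp_mul_I_le_of_le_abs_deriv {h h' h'' : ℝ → ℝ} {a b l : ℝ} (hab : a ≤ b)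
    (hl : 0 < l) (hh : ∀ x ∈ Set.Icc a b, HasDerivAt h (h' x) x)
    (hh' : ∀ x ∈ Set.Icc a b, HasDerivAt h' (h'' x) x)
    (hcont : ContinuousOn h'' (Set.Icc a b)) (hnn : ∀ x ∈ Set.Icc a b, 0 ≤ h'' x)
    (hlow : (∀ x ∈ Set.Icc a b, l ≤ h' x) ∨ (∀ x ∈ Set.Icc a b, h' x ≤ -l)) :
    ‖∫ x in a..b, Complex.exp (h x * Complex.I)‖ ≤ 2 / l := by
  have hne : ∀ x ∈ Set.Icc a b, h' x ≠ 0 := by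
    intro x hx
    rcases hlow with H | H
    · exact (hl.trans_le (H x hx)).ne'
    · exact ((H x hx).trans_lt (neg_lt_zero.2 hl)).ne
  have hhc : ContinuousOn h (Set.Icc a b) := fun x hx => (hh x hx).continuousAt.continuousWithinAt
  have hhc' : ContinuousOn h' (Set.Icc a b) :=
    fun x hx => (hh' x hx).continuousAt.continuousWithinAt
  have hec : ContinuousOn (fun x => Complex.exp (h x * Complex.I)) (Set.Icc a b) := by
    fun_prop
  have hqc : ContinuousOn (fun x => h'' x / h' x ^ 2) (Set.Icc a b) :=
    hcont.div (hhc'.pow 2) fun x hx => pow_ne_zero 2 (hne x hx)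
  have hrc : ContinuousOn (fun x => Complex.exp (h x * Complex.I) *
      ((h'' x / h' x ^ 2 : ℝ) : ℂ) * (-Complex.I)) (Set.Icc a b) := by
    have : ContinuousOn (fun x => ((h'' x / h' x ^ 2 : ℝ) : ℂ)) (Set.Icc a b) :=
      Complex.continuous_ofReal.comp_continuousOn hqc
    exact (hec.mul this).mul continuousOn_const
  have hu : Set.uIcc a b = Set.Icc a b := Set.uIcc_of_le hab
  -- Integration by parts: e^{ih} is the derivative of e^{ih}/(ih') plus an error of modulus
  -- h''/h'².
  have hF : ∀ x ∈ Set.uIcc a b, HasDerivAt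
      (fun x => Complex.exp (h x * Complex.I) * ((h' x : ℂ)⁻¹ * (-Complex.I)))
      (Complex.exp (h x * Complex.I) - Complex.exp (h x * Complex.I) *
        ((h'' x / h' x ^ 2 : ℝ) : ℂ) * (-Complex.I)) x := by
    intro x hx
    rw [hu] at hx
    have h1 := (((hh x hx).ofReal_comp).mul_const Complex.I).cexp
    have hn : (h' x : ℂ) ≠ 0 := by exact_mod_cast hne x hx
    have h2 : HasDerivAt (fun y => (h' y : ℂ)⁻¹ * -Complex.I)
        (-(h'' x : ℂ) / (h' x : ℂ) ^ 2 * -Complex.I) x :=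
      ((hh' x hx).ofReal_comp.inv hn).mul_const (-Complex.I)
    refine (h1.mul h2).congr_deriv ?_
    push_cast
    field_simp
    linear_combination (-h' x ^ 2 : ℂ) * Complex.I_sq
  have hi1 : IntervalIntegrable (fun x => Complex.exp (h x * Complex.I)) volume a b :=
    (hu ▸ hec).intervalIntegrable
  have hi2 : IntervalIntegrable (fun x => Complex.exp (h x * Complex.I) *
        ((h'' x / h' x ^ 2 : ℝ) : ℂ) * (-Complex.I)) volume a b := (hu ▸ hrc).intervalIntegrable
  have hi3 : IntervalIntegrable (fun x => h'' x / h' x ^ 2) volume a b :=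
    (hu ▸ hqc).intervalIntegrable
  have e1 := intervalIntegral.integral_eq_sub_of_hasDerivAt hF (hi1.sub hi2)
  rw [intervalIntegral.integral_sub hi1 hi2] at e1
  -- By convexity the error integrates exactly to 1/h'(a) - 1/h'(b). Added to the two boundary
  -- terms, it leaves 2/h'(a) if h' > 0 and -2/h'(b) if h' < 0.
  have hG : ∀ x ∈ Set.uIcc a b, HasDerivAt (fun x => - (h' x)⁻¹) (h'' x / h' x ^ 2) x := by
    intro x hx
    rw [hu] at hx
    refine ((hh' x hx).inv (hne x hx)).neg.congr_deriv ?_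
    ring
  have e2 := intervalIntegral.integral_eq_sub_of_hasDerivAt hG hi3
  have e3 : ‖∫ x in a..b, Complex.exp (h x * Complex.I) *
        ((h'' x / h' x ^ 2 : ℝ) : ℂ) * (-Complex.I)‖ ≤ ∫ x in a..b, h'' x / h' x ^ 2 := by
    refine intervalIntegral.norm_integral_le_of_norm_le hab ?_ hi3
    refine Filter.Eventually.of_forall fun x hx => ?_
    have hx' : x ∈ Set.Icc a b := Set.Ioc_subset_Icc_self hx
    rw [norm_mul, norm_mul, Complex.norm_exp_ofReal_mul_I, norm_neg, Complex.norm_I,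
      Complex.norm_real, one_mul, mul_one, Real.norm_of_nonneg]
    exact div_nonneg (hnn x hx') (sq_nonneg _)
  have e4 : ∀ x, ‖Complex.exp (h x * Complex.I) * ((h' x : ℂ)⁻¹ * (-Complex.I))‖ = |(h' x)⁻¹| := by
    intro x
    rw [norm_mul, norm_mul, Complex.norm_exp_ofReal_mul_I, norm_neg, Complex.norm_I, norm_inv,
      Complex.norm_real, one_mul, mul_one, abs_inv, Real.norm_eq_abs]
  have e5 : (∫ x in a..b, Complex.exp (h x * Complex.I)) =
    (Complex.exp (h b * Complex.I) * ((h' b : ℂ)⁻¹ * (-Complex.I)) -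
      Complex.exp (h a * Complex.I) * ((h' a : ℂ)⁻¹ * (-Complex.I))) +
      ∫ x in a..b, Complex.exp (h x * Complex.I) *
        ((h'' x / h' x ^ 2 : ℝ) : ℂ) * (-Complex.I) := by
    linear_combination e1
  rw [e5]
  refine (norm_add_le _ _).trans ((add_le_add (norm_sub_le _ _) e3).trans ?_)
  rw [e4, e4, e2]
  have ha : a ∈ Set.Icc a b := Set.left_mem_Icc.2 hab
  have hb : b ∈ Set.Icc a b := Set.right_mem_Icc.2 hab
  have key : 2 / l = 2 * l⁻¹ := by ring
  rw [key]
  rcases hlow with H | H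
  · have p1 : 0 < (h' a)⁻¹ := inv_pos.2 (hl.trans_le (H a ha))
    have p2 : 0 < (h' b)⁻¹ := inv_pos.2 (hl.trans_le (H b hb))
    have p3 : (h' a)⁻¹ ≤ l⁻¹ := inv_anti₀ hl (H a ha)
    rw [abs_of_pos p1, abs_of_pos p2]
    linarith
  · have p1 : (h' a)⁻¹ < 0 := inv_lt_zero.2 (by linarith [H a ha])
    have p2 : (h' b)⁻¹ < 0 := inv_lt_zero.2 (by linarith [H b hb])
    have p3 : (- h' b)⁻¹ ≤ l⁻¹ := inv_anti₀ hl (by linarith [H b hb])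
    rw [inv_neg] at p3
    rw [abs_of_neg p1, abs_of_neg p2]
    linarith

/-- Second derivative test (van der Corput). -/
theorem norm_integral_exp_mul_I_le_of_le_deriv2 {h h' h'' : ℝ → ℝ} {a b c : ℝ} (hab : a ≤ b)
    (hc : 0 < c) (hh : ∀ x ∈ Set.Icc a b, HasDerivAt h (h' x) x)
    (hh' : ∀ x ∈ Set.Icc a b, HasDerivAt h' (h'' x) x)
    (hcont : ContinuousOn h'' (Set.Icc a b)) (hlow : ∀ x ∈ Set.Icc a b, c ≤ h'' x) :
    ‖∫ x in a..b, Complex.exp (h x * Complex.I)‖ ≤ 4 * √(2 / c) := by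
  have hhc' : ContinuousOn h' (Set.Icc a b) :=
    fun x hx => (hh' x hx).continuousAt.continuousWithinAt
  have hhc : ContinuousOn h (Set.Icc a b) := fun x hx => (hh x hx).continuousAt.continuousWithinAt
  have hmono : ∀ x ∈ Set.Icc a b, ∀ y ∈ Set.Icc a b, x ≤ y → c * (y - x) ≤ h' y - h' x := by
    intro x hx y hy hxy
    refine (convex_Icc a b).mul_sub_le_image_sub_of_le_deriv hhc' ?_ ?_ x hx y hy hxy
    · exact fun z hz => (hh' z (interior_subset hz)).differentiableAt.differentiableWithinAt
    · intro z hz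
      rw [(hh' z (interior_subset hz)).deriv]
      exact hlow z (interior_subset hz)
  have ha : a ∈ Set.Icc a b := Set.left_mem_Icc.2 hab
  have hb : b ∈ Set.Icc a b := Set.right_mem_Icc.2 hab
  -- γ is the zero of h', or the endpoint nearest to a zero when h' keeps its sign. In the latter
  -- case one side of γ is empty, which the alternative γ = x accounts for.
  obtain ⟨γ, hγ, hγ1, hγ2⟩ : ∃ γ ∈ Set.Icc a b,
      (∀ x ∈ Set.Icc a b, γ ≤ x → γ = x ∨ c * (x - γ) ≤ h' x) ∧
      (∀ x ∈ Set.Icc a b, x ≤ γ → γ = x ∨ h' x ≤ -(c * (γ - x))) := by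
    by_cases h1 : 0 ≤ h' a
    · refine ⟨a, ha, fun x hx hx' => Or.inr ?_, fun x hx hx' => Or.inl (le_antisymm hx.1 hx')⟩
      linarith [hmono a ha x hx hx']
    by_cases h2 : h' b ≤ 0
    · refine ⟨b, hb, fun x hx hx' => Or.inl (le_antisymm hx' hx.2), fun x hx hx' => Or.inr ?_⟩
      linarith [hmono x hx b hb hx']
    push Not at h1 h2
    obtain ⟨γ, hγ, hγ0⟩ := intermediate_value_Icc hab hhc' ⟨h1.le, h2.le⟩
    refine ⟨γ, hγ, fun x hx hx' => Or.inr ?_, fun x hx hx' => Or.inr ?_⟩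
    · linarith [hmono γ hγ x hx hx']
    · linarith [hmono x hx γ hγ hx']
  -- With cδ² = 2 the first derivative test off the window of radius δ about γ gives 2/(cδ) = δ on
  -- each side, and the window itself contributes at most 2δ.
  set δ := √(2 / c) with hδ
  have hδ0 : 0 < δ := Real.sqrt_pos.2 (by positivity)
  have hδ2 : c * δ ^ 2 = 2 := by
    rw [hδ, Real.sq_sqrt (by positivity)]
    field_simp
  have hcd : 2 / (c * δ) = δ := by
    rw [← hδ2]
    field_simp
  set α := max a (γ - δ) with hα
  set β := min b (γ + δ) with hβ
  have haα : a ≤ α := le_max_left _ _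
  have hαγ : α ≤ γ := max_le hγ.1 (by linarith)
  have hγβ : γ ≤ β := le_min hγ.2 (by linarith)
  have hβb : β ≤ b := min_le_left _ _
  have hec : ContinuousOn (fun x => Complex.exp (h x * Complex.I)) (Set.Icc a b) := by
    fun_prop
  have hint : ∀ x y, a ≤ x → x ≤ y → y ≤ b →
      IntervalIntegrable (fun x => Complex.exp (h x * Complex.I)) volume x y := by
    intro x y hx hxy hy
    refine (hec.mono ?_).intervalIntegrable
    rw [Set.uIcc_of_le hxy]
    exact Set.Icc_subset_Icc hx hy
  have i1 := hint a α le_rfl haα (by linarith)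
  have i2 := hint α β haα (by linarith) hβb
  have i3 := hint β b (by linarith) hβb le_rfl
  have b2 : ‖∫ x in α..β, Complex.exp (h x * Complex.I)‖ ≤ 2 * δ := by
    have := intervalIntegral.norm_integral_le_of_norm_le_const
      (f := fun x => Complex.exp (h x * Complex.I)) (a := α) (b := β) (C := 1)
      fun x _ => (Complex.norm_exp_ofReal_mul_I _).le
    refine this.trans ?_
    rw [abs_of_nonneg (by linarith)]
    linarith [le_max_right a (γ - δ), min_le_right b (γ + δ)]
  have b1 : ‖∫ x in a..α, Complex.exp (h x * Complex.I)‖ ≤ δ := by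
    rcases haα.eq_or_lt with h0 | h0
    · rw [← h0]; simpa using hδ0.le
    have hα' : α = γ - δ := by
      rcases max_choice a (γ - δ) with h3 | h3
      · exact absurd (hα.trans h3) h0.ne'
      · exact h3
    rw [← hcd]
    have hsub : Set.Icc a α ⊆ Set.Icc a b := Set.Icc_subset_Icc le_rfl (by linarith)
    refine norm_integral_exp_mul_I_le_of_le_abs_deriv haα (by positivity)
      (fun x hx => hh x (hsub hx)) (fun x hx => hh' x (hsub hx)) (hcont.mono hsub)
      (fun x hx => hc.le.trans (hlow x (hsub hx))) (Or.inr fun x hx => ?_)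
    rcases hγ2 x (hsub hx) (hx.2.trans hαγ) with h4 | h4
    · linarith [hx.2]
    · refine h4.trans (neg_le_neg (mul_le_mul_of_nonneg_left ?_ hc.le))
      linarith [hx.2]
  have b3 : ‖∫ x in β..b, Complex.exp (h x * Complex.I)‖ ≤ δ := by
    rcases hβb.eq_or_lt with h0 | h0
    · rw [h0]; simpa using hδ0.le
    have hβ' : β = γ + δ := by
      rcases min_choice b (γ + δ) with h3 | h3
      · exact absurd (hβ.trans h3) h0.ne
      · exact h3
    rw [← hcd]
    have hsub : Set.Icc β b ⊆ Set.Icc a b := Set.Icc_subset_Icc (by linarith) le_rfl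
    refine norm_integral_exp_mul_I_le_of_le_abs_deriv hβb (by positivity)
      (fun x hx => hh x (hsub hx)) (fun x hx => hh' x (hsub hx)) (hcont.mono hsub)
      (fun x hx => hc.le.trans (hlow x (hsub hx))) (Or.inl fun x hx => ?_)
    rcases hγ1 x (hsub hx) (hγβ.trans hx.1) with h4 | h4
    · linarith [hx.1]
    · refine le_trans (mul_le_mul_of_nonneg_left ?_ hc.le) h4
      linarith [hx.1]
  rw [← intervalIntegral.integral_add_adjacent_intervals (i1.trans i2) i3,
    ← intervalIntegral.integral_add_adjacent_intervals i1 i2]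
  refine (norm_add₃_le).trans ?_
  linarith

/-! ### The toll function g as a phase -/

theorem continuous_quicksortG : Continuous quicksortG := by
  unfold quicksortG
  have h1 : Continuous fun u : ℝ => u * Real.log u := Real.continuous_mul_log
  have h2 : Continuous fun u : ℝ => (1 - u) * Real.log (1 - u) :=
    Real.continuous_mul_log.comp (continuous_const.sub continuous_id)
  have : (fun u : ℝ => 2 * u * Real.log u + 2 * (1 - u) * Real.log (1 - u) + 1) =
      fun u => 2 * (u * Real.log u) + 2 * ((1 - u) * Real.log (1 - u)) + 1 := by
    ext u; ring
  rw [this]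
  fun_prop

theorem hasDerivAt_quicksortG {u : ℝ} (h0 : u ≠ 0) (h1 : 1 - u ≠ 0) :
    HasDerivAt quicksortG (2 * Real.log u - 2 * Real.log (1 - u)) u := by
  unfold quicksortG
  have a1 := (((hasDerivAt_id u).const_mul 2).mul (Real.hasDerivAt_log h0))
  have a2 := (((hasDerivAt_id u).const_sub 1).const_mul 2).mul
    (((hasDerivAt_id u).const_sub 1).log h1)
  refine ((a1.add a2).add_const 1).congr_deriv ?_
  simp only [id]
  field_simp
  ring

/-- The linear term does not affect the second derivative, which is at least 8t, so the bound
4√(2/(8t)) is uniform in a. As g' blows up at both endpoints, the test is applied on [η, 1-η] and η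
tends to 0. -/
theorem norm_integral_exp_quicksortG_le {t : ℝ} (ht : 0 < t) (a : ℝ) :
    ‖∫ u in (0 : ℝ)..1, Complex.exp ((t * (a * u + quicksortG u) : ℝ) * Complex.I)‖ ≤
      2 / √t := by
  have hcont : Continuous fun u : ℝ =>
      Complex.exp ((t * (a * u + quicksortG u) : ℝ) * Complex.I) := by
    have := continuous_quicksortG
    fun_prop
  have key : ∀ η ∈ Set.Ioo (0 : ℝ) (1 / 2),
      ‖∫ u in η..(1 - η), Complex.exp ((t * (a * u + quicksortG u) : ℝ) * Complex.I)‖ ≤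
        2 / √t := by
    intro η hη
    have hn0 : ∀ u ∈ Set.Icc η (1 - η), 0 < u := fun u hu => hη.1.trans_le hu.1
    have hn1 : ∀ u ∈ Set.Icc η (1 - η), 0 < 1 - u := fun u hu => by linarith [hη.1, hu.2]
    have := norm_integral_exp_mul_I_le_of_le_deriv2
      (h := fun u => t * (a * u + quicksortG u))
      (h' := fun u => t * (a + (2 * Real.log u - 2 * Real.log (1 - u))))
      (h'' := fun u => t * (2 / u + 2 / (1 - u))) (a := η) (b := 1 - η) (c := 8 * t)
      (by linarith [hη.2]) (by positivity) ?_ ?_ ?_ ?_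
    · refine this.trans (le_of_eq ?_)
      rw [show 2 / (8 * t) = (1 / 2) ^ 2 / t by field_simp; norm_num, Real.sqrt_div (by positivity),
        Real.sqrt_sq (by norm_num)]
      ring
    · intro u hu
      refine ((((hasDerivAt_id u).const_mul a).add
        (hasDerivAt_quicksortG (hn0 u hu).ne' (hn1 u hu).ne')).const_mul t).congr_deriv ?_
      simp
    · intro u hu
      refine (((((Real.hasDerivAt_log (hn0 u hu).ne').const_mul 2).sub
        ((((hasDerivAt_id u).const_sub 1).log (hn1 u hu).ne').const_mul 2)).const_add
          a).const_mul t).congr_deriv ?_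
      simp only [id]
      field_simp
      ring
    · refine continuousOn_const.mul (ContinuousOn.add ?_ ?_)
      · exact continuousOn_const.div continuousOn_id fun u hu => (hn0 u hu).ne'
      · exact continuousOn_const.div (by fun_prop) fun u hu => (hn1 u hu).ne'
    · intro u hu
      have p0 := hn0 u hu
      have p1 := hn1 u hu
      have : 8 ≤ 2 / u + 2 / (1 - u) := by
        rw [div_add_div _ _ p0.ne' p1.ne', le_div_iff₀ (by positivity)]
        nlinarith [sq_nonneg (1 - 2 * u)]
      show 8 * t ≤ t * (2 / u + 2 / (1 - u))
      nlinarith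
  have hlim : Filter.Tendsto
      (fun η : ℝ => ‖∫ u in η..(1 - η), Complex.exp ((t * (a * u + quicksortG u) : ℝ) * Complex.I)‖)
      (nhdsWithin 0 (Set.Ioi 0))
      (nhds ‖∫ u in (0 : ℝ)..1, Complex.exp ((t * (a * u + quicksortG u) : ℝ) * Complex.I)‖) := by
    set F : ℝ → ℂ := fun x => ∫ u in (0 : ℝ)..x,
      Complex.exp ((t * (a * u + quicksortG u) : ℝ) * Complex.I) with hF
    have hFc : Continuous F := intervalIntegral.continuous_primitive
      (fun x y => hcont.intervalIntegrable x y) 0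
    have : (fun η : ℝ => ∫ u in η..(1 - η),
        Complex.exp ((t * (a * u + quicksortG u) : ℝ) * Complex.I)) =
        fun η => F (1 - η) - F η := by
      ext η
      rw [hF, intervalIntegral.integral_interval_sub_left] <;>
        exact hcont.intervalIntegrable _ _
    have hc2 : Continuous fun η : ℝ => ∫ u in η..(1 - η),
        Complex.exp ((t * (a * u + quicksortG u) : ℝ) * Complex.I) := by
      rw [this]; fun_prop
    have := (hc2.norm.tendsto 0).mono_left (nhdsWithin_le_nhds (s := Set.Ioi 0))
    simpa using this
  refine le_of_tendsto hlim ?_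
  filter_upwards [Ioo_mem_nhdsGT (show (0 : ℝ) < 1 / 2 by norm_num)] with η hη using key η hη

/-! ### The operator S on characteristic functions -/

theorem measurable_quicksortS_map : Measurable
    (fun w : ℝ × ℝ × ℝ => w.1 * w.2.1 + (1 - w.1) * w.2.2 + quicksortG w.1) := by
  have := continuous_quicksortG.measurable
  fun_prop

instance isProbabilityMeasure_restrict_Icc_zero_one :
    IsProbabilityMeasure (volume.restrict (Set.Icc (0 : ℝ) 1)) :=
  ⟨by simp⟩

instance isProbabilityMeasure_quicksortS (μ : Measure ℝ) [IsProbabilityMeasure μ] :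
    IsProbabilityMeasure (quicksortS μ) :=
  Measure.isProbabilityMeasure_map measurable_quicksortS_map.aemeasurable

instance isProbabilityMeasure_iterate_quicksortS (μ : Measure ℝ) [IsProbabilityMeasure μ] (n : ℕ) :
    IsProbabilityMeasure (quicksortS^[n] μ) := by
  induction n with
  | zero => simpa
  | succ n ih => rw [Function.iterate_succ_apply']; infer_instance

theorem measurable_exp_quicksortS (t : ℝ) : Measurable (fun w : ℝ × ℝ × ℝ =>
    Complex.exp (t * (w.1 * w.2.1 + (1 - w.1) * w.2.2 + quicksortG w.1 : ℝ) * Complex.I)) := by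
  have := measurable_quicksortS_map
  fun_prop

theorem integrable_exp_quicksortS (μ : Measure ℝ) [IsProbabilityMeasure μ] (t : ℝ) :
    Integrable (fun w : ℝ × ℝ × ℝ =>
      Complex.exp (t * (w.1 * w.2.1 + (1 - w.1) * w.2.2 + quicksortG w.1 : ℝ) * Complex.I))
      ((volume.restrict (Set.Icc (0 : ℝ) 1)).prod (μ.prod μ)) := by
  refine Integrable.of_bound (measurable_exp_quicksortS t).aestronglyMeasurable 1 ?_
  refine Filter.Eventually.of_forall fun w => ?_
  rw [← Complex.ofReal_mul, Complex.norm_exp_ofReal_mul_I]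

theorem charFun_quicksortS_eq_integral_prod (μ : Measure ℝ) (t : ℝ) :
    charFun (quicksortS μ) t = ∫ w : ℝ × ℝ × ℝ,
      Complex.exp (t * (w.1 * w.2.1 + (1 - w.1) * w.2.2 + quicksortG w.1 : ℝ) * Complex.I)
      ∂((volume.restrict (Set.Icc (0 : ℝ) 1)).prod (μ.prod μ)) := by
  rw [charFun_apply_real, quicksortS, integral_map measurable_quicksortS_map.aemeasurable]
  exact Measurable.aestronglyMeasurable (by fun_prop)

theorem charFun_quicksortS (μ : Measure ℝ) [IsProbabilityMeasure μ] (t : ℝ) :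
    charFun (quicksortS μ) t = ∫ u in (0 : ℝ)..1, charFun μ (u * t) * charFun μ ((1 - u) * t) *
      Complex.exp (t * quicksortG u * Complex.I) := by
  rw [charFun_quicksortS_eq_integral_prod, integral_prod _ (integrable_exp_quicksortS μ t),
    intervalIntegral.integral_of_le zero_le_one, ← integral_Icc_eq_integral_Ioc]
  congr 1
  ext u
  rw [charFun_apply_real, charFun_apply_real, ← integral_prod_mul, ← integral_mul_const]
  congr 1
  ext w
  rw [← Complex.exp_add, ← Complex.exp_add]
  congr 1
  push_cast
  ring

theorem norm_charFun_neg (μ : Measure ℝ) (t : ℝ) : ‖charFun μ (-t)‖ = ‖charFun μ t‖ := by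
  rw [charFun_neg, RCLike.norm_conj]

theorem norm_charFun_abs (μ : Measure ℝ) (t : ℝ) : ‖charFun μ |t|‖ = ‖charFun μ t‖ := by
  rcases abs_choice t with h | h <;> rw [h]
  exact norm_charFun_neg μ t

/-- Integrating over u first, with V and V* frozen, leaves the oscillatory integral with slope V -
V*. Its bound is uniform in the slope, so nothing is asked of μ. -/
theorem norm_charFun_quicksortS_le_of_pos (μ : Measure ℝ) [IsProbabilityMeasure μ] {t : ℝ}
    (ht : 0 < t) : ‖charFun (quicksortS μ) t‖ ≤ 2 / √t := by
  rw [charFun_quicksortS_eq_integral_prod, integral_prod_symm _ (integrable_exp_quicksortS μ t)]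
  have : ∀ v : ℝ × ℝ, ‖∫ u in Set.Icc (0 : ℝ) 1,
      Complex.exp (t * (u * v.1 + (1 - u) * v.2 + quicksortG u : ℝ) * Complex.I)‖ ≤ 2 / √t := by
    intro v
    have h := norm_integral_exp_quicksortG_le ht (v.1 - v.2)
    rw [integral_Icc_eq_integral_Ioc, ← intervalIntegral.integral_of_le zero_le_one]
    have e : ∀ u : ℝ, Complex.exp (t * (u * v.1 + (1 - u) * v.2 + quicksortG u : ℝ) * Complex.I) =
        Complex.exp ((t * v.2 : ℝ) * Complex.I) *
        Complex.exp ((t * ((v.1 - v.2) * u + quicksortG u) : ℝ) * Complex.I) := by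
      intro u
      rw [← Complex.exp_add]
      congr 1
      push_cast
      ring
    simp_rw [e]
    rwa [intervalIntegral.integral_const_mul, norm_mul, Complex.norm_exp_ofReal_mul_I, one_mul]
  refine (norm_integral_le_of_norm_le_const (Filter.Eventually.of_forall this)).trans ?_
  simp

theorem continuous_norm_charFun_mul (μ : Measure ℝ) [IsProbabilityMeasure μ] (t : ℝ) :
    Continuous fun u : ℝ => ‖charFun μ (u * t)‖ * ‖charFun μ ((1 - u) * t)‖ := by
  have : Continuous (charFun μ) := continuous_charFun
  fun_prop

theorem norm_charFun_quicksortS_le_integral (μ : Measure ℝ) [IsProbabilityMeasure μ] (t : ℝ) :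
    ‖charFun (quicksortS μ) t‖ ≤
      ∫ u in (0 : ℝ)..1, ‖charFun μ (u * t)‖ * ‖charFun μ ((1 - u) * t)‖ := by
  rw [charFun_quicksortS]
  refine intervalIntegral.norm_integral_le_of_norm_le zero_le_one
    (Filter.Eventually.of_forall fun u _ => ?_)
    ((continuous_norm_charFun_mul μ t).intervalIntegrable _ _)
  rw [norm_mul, norm_mul, ← Complex.ofReal_mul, Complex.norm_exp_ofReal_mul_I, mul_one]

theorem norm_charFun_quicksortS_le_half (μ : Measure ℝ) [IsProbabilityMeasure μ] (t : ℝ) :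
    ‖charFun (quicksortS μ) t‖ ≤
      2 * ∫ u in (0 : ℝ)..(1 / 2), ‖charFun μ (u * t)‖ * ‖charFun μ ((1 - u) * t)‖ := by
  refine (norm_charFun_quicksortS_le_integral μ t).trans (le_of_eq ?_)
  have hi := fun a b => (continuous_norm_charFun_mul μ t).intervalIntegrable (μ := volume) a b
  rw [← intervalIntegral.integral_add_adjacent_intervals (hi 0 (1 / 2)) (hi (1 / 2) 1), two_mul]
  congr 1
  have := intervalIntegral.integral_comp_sub_left (a := 0) (b := 1 / 2)
    (fun u => ‖charFun μ (u * t)‖ * ‖charFun μ ((1 - u) * t)‖) 1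
  rw [show (1 : ℝ) - 1 / 2 = 1 / 2 by norm_num, sub_zero] at this
  rw [← this]
  congr 1
  ext u
  rw [sub_sub_cancel, mul_comm]

/-! ### Bootstrapping the decay exponent -/

/-- The characteristic function of `μ` satisfies `|φ(t)| ≤ c t ^ (-p)` for `t > 0`. -/
def HasCharFunDecay (p c : ℝ) (μ : Measure ℝ) : Prop :=
  ∀ t : ℝ, 0 < t → ‖charFun μ t‖ ≤ c * t ^ (-p)

/-- All laws `S ^ n μ` with `n ≥ m` have the same power decay of the characteristic function. -/
def UniformCharFunDecay (m : ℕ) (p c : ℝ) : Prop :=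
  ∀ μ : Measure ℝ, IsProbabilityMeasure μ → ∀ n : ℕ, m ≤ n → HasCharFunDecay p c (quicksortS^[n] μ)

theorem HasCharFunDecay.mono {p c c' : ℝ} {μ : Measure ℝ} (h : HasCharFunDecay p c μ)
    (hc : c ≤ c') : HasCharFunDecay p c' μ := fun t ht =>
  (h t ht).trans (mul_le_mul_of_nonneg_right hc (by positivity))

/-- Since |φ| ≤ 1, |φ| ≤ |φ|^θ for θ = q/p ≤ 1. -/
theorem HasCharFunDecay.interpolate {p q c : ℝ} {μ : Measure ℝ} [IsProbabilityMeasure μ]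
    (h : HasCharFunDecay p c μ) (hc : 0 < c) (hq : 0 < q) (hqp : q ≤ p) :
    HasCharFunDecay q (c ^ (q / p)) μ := by
  intro t ht
  have hp : 0 < p := hq.trans_le hqp
  have hθ : 0 ≤ q / p := by positivity
  have hθ1 : q / p ≤ 1 := (div_le_one hp).2 hqp
  have e : c ^ (q / p) * t ^ (-q) = (c * t ^ (-p)) ^ (q / p) := by
    rw [Real.mul_rpow hc.le (by positivity), ← Real.rpow_mul ht.le]
    congr 2
    field_simp
  rw [e]
  have h1 := Real.rpow_le_rpow (norm_nonneg _) (h t ht) hθ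
  refine le_trans ?_ h1
  exact Real.self_le_rpow_of_le_one (norm_nonneg _) (norm_charFun_le_one t) hθ1

/-- By symmetry only u ≤ 1/2 matters. There (1-u)t ≥ t/2, so one factor takes the full decay and
comes out of the integral; the substitution s = ut in the other factor yields the extra t⁻¹. -/
theorem norm_charFun_quicksortS_le_of_decay {p c : ℝ} {μ : Measure ℝ} [IsProbabilityMeasure μ]
    (h : HasCharFunDecay p c μ) (hc : 0 ≤ c) (hp : 0 ≤ p) {t : ℝ} (ht : 0 < t) :
    ‖charFun (quicksortS μ) t‖ ≤
      2 * (c * (t / 2) ^ (-p)) * (t⁻¹ * ∫ s in (0 : ℝ)..(t / 2), ‖charFun μ s‖) := by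
  have hcf : Continuous (charFun μ) := continuous_charFun
  refine (norm_charFun_quicksortS_le_half μ t).trans ?_
  rw [mul_assoc]
  refine mul_le_mul_of_nonneg_left ?_ zero_le_two
  have e := intervalIntegral.integral_comp_mul_right (a := 0) (b := 1 / 2)
    (fun s => ‖charFun μ s‖) ht.ne'
  rw [zero_mul, smul_eq_mul, show 1 / 2 * t = t / 2 by ring] at e
  rw [← e, ← intervalIntegral.integral_const_mul]
  refine intervalIntegral.integral_mono_on (by norm_num)
    ((continuous_norm_charFun_mul μ t).intervalIntegrable _ _)
    (Continuous.intervalIntegrable (by fun_prop) _ _) fun u hu => ?_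
  rw [mul_comm]
  refine mul_le_mul_of_nonneg_right ?_ (norm_nonneg _)
  have h1 : t / 2 ≤ (1 - u) * t := by nlinarith [hu.2]
  refine (h _ (by linarith)).trans (mul_le_mul_of_nonneg_left ?_ hc)
  exact Real.rpow_le_rpow_of_nonpos (by positivity) h1 (by linarith)

theorem hasCharFunDecay_half_quicksortS (μ : Measure ℝ) [IsProbabilityMeasure μ] :
    HasCharFunDecay (1 / 2) 2 (quicksortS μ) := by
  intro t ht
  refine (norm_charFun_quicksortS_le_of_pos μ ht).trans (le_of_eq ?_)
  rw [Real.rpow_neg ht.le, ← Real.sqrt_eq_rpow, div_eq_mul_inv]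

/-- For p < 1 the bound c s^(-p) is integrable at 0 and its integral grows like t^(1-p); the
exponent doubles. -/
theorem HasCharFunDecay.quicksortS_of_lt_one {p c : ℝ} {μ : Measure ℝ} [IsProbabilityMeasure μ]
    (h : HasCharFunDecay p c μ) (hc : 0 < c) (hp : 0 < p) (hp1 : p < 1) :
    HasCharFunDecay (2 * p) (c ^ 2 * 2 ^ (2 * p) / (1 - p)) (quicksortS μ) := by
  intro t ht
  have hcf : Continuous (charFun μ) := continuous_charFun
  refine (norm_charFun_quicksortS_le_of_decay h hc.le hp.le ht).trans ?_
  have h1 : ∫ s in (0 : ℝ)..(t / 2), ‖charFun μ s‖ ≤ ∫ s in (0 : ℝ)..(t / 2), c * s ^ (-p) := by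
    refine intervalIntegral.integral_mono_on_of_le_Ioo (by positivity)
      (Continuous.intervalIntegrable (by fun_prop) _ _)
      ((intervalIntegral.intervalIntegrable_rpow' (by linarith)).const_mul c)
      fun s hs => h s hs.1
  rw [intervalIntegral.integral_const_mul, integral_rpow (Or.inl (by linarith)),
    Real.zero_rpow (by linarith), sub_zero] at h1
  refine (mul_le_mul_of_nonneg_left (mul_le_mul_of_nonneg_left h1 (by positivity))
    (by positivity)).trans (le_of_eq ?_)
  have e1 : (t / 2) ^ (-p + 1) = (t / 2) ^ (-p) * (t / 2) := by
    rw [Real.rpow_add_one (by positivity)]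
  have e2 : 2 ^ (2 * p) * t ^ (-(2 * p)) = (t / 2) ^ (-p) * (t / 2) ^ (-p) := by
    rw [← Real.rpow_add (by positivity), Real.div_rpow ht.le zero_le_two,
      show -p + -p = -(2 * p) by ring, Real.rpow_neg zero_le_two, div_inv_eq_mul, mul_comm]
  have : 1 - p ≠ 0 := by linarith
  have e3 : -p + 1 = 1 - p := by ring
  calc _ = c ^ 2 * ((t / 2) ^ (-p) * (t / 2) ^ (-p)) / (1 - p) := by
        rw [e1, e3]; field_simp
    _ = _ := by rw [← e2]; ring

/-- The bound 1 is used up to a = c^(1/p), where c s^(-p) equals 1, and the decay beyond it. -/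
theorem integral_norm_charFun_le_of_one_lt {p c : ℝ} {μ : Measure ℝ} [IsProbabilityMeasure μ]
    (h : HasCharFunDecay p c μ) (hc : 0 < c) (hp : 1 < p) {T : ℝ} (hT : 0 ≤ T) :
    ∫ s in (0 : ℝ)..T, ‖charFun μ s‖ ≤ c ^ (1 / p) * (p / (p - 1)) := by
  have hcf : Continuous (charFun μ) := continuous_charFun
  have hi : ∀ a b, IntervalIntegrable (fun s => ‖charFun μ s‖) volume a b :=
    fun a b => hcf.norm.intervalIntegrable a b
  set a := c ^ (1 / p) with ha
  have ha0 : 0 < a := by positivity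
  have hap : c = a ^ p := by
    rw [ha, ← Real.rpow_mul hc.le, one_div, inv_mul_cancel₀ (by linarith), Real.rpow_one]
  have h1 : ∀ x, 0 ≤ x → ∫ s in (0 : ℝ)..x, ‖charFun μ s‖ ≤ x := by
    intro x hx
    have := intervalIntegral.integral_mono_on hx (hi 0 x)
      (intervalIntegrable_const (c := (1 : ℝ))) fun s _ => norm_charFun_le_one s
    simpa using this
  have hp1 : 0 < p - 1 := by linarith
  have e : a * (p / (p - 1)) = a + a / (p - 1) := by field_simp; ring
  rcases le_total T a with hTa | hTa
  · refine (h1 T hT).trans (hTa.trans ?_)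
    rw [e]
    linarith [show 0 < a / (p - 1) by positivity]
  · rw [← intervalIntegral.integral_add_adjacent_intervals (hi 0 a) (hi a T), e]
    refine add_le_add (h1 a ha0.le) ?_
    have h0 : (0 : ℝ) ∉ Set.uIcc a T := by
      rw [Set.uIcc_of_le hTa]; exact fun H => absurd H.1 (not_le.2 ha0)
    have h2 : ∫ s in a..T, ‖charFun μ s‖ ≤ ∫ s in a..T, c * s ^ (-p) := by
      refine intervalIntegral.integral_mono_on hTa (hi a T)
        ((intervalIntegral.intervalIntegrable_rpow (Or.inr h0)).const_mul c)
        fun s hs => h s (ha0.trans_le hs.1)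
    rw [intervalIntegral.integral_const_mul, integral_rpow (Or.inr ⟨by linarith, h0⟩)] at h2
    refine h2.trans ?_
    have e1 : c * a ^ (-p + 1) = a := by
      rw [hap, ← Real.rpow_add ha0]; simp
    have h3 : 0 ≤ T ^ (-p + 1) := Real.rpow_nonneg hT _
    rw [show -p + 1 = -(p - 1) by ring] at *
    rw [div_neg, ← neg_div, neg_sub, mul_div_assoc', mul_sub, e1]
    refine div_le_div_of_nonneg_right ?_ hp1.le
    linarith [mul_nonneg hc.le h3]

/-- For p > 1 the remaining integral is bounded in t, so the factor t⁻¹ is a full gain of one power.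
-/
theorem HasCharFunDecay.quicksortS_of_one_lt {p c : ℝ} {μ : Measure ℝ} [IsProbabilityMeasure μ]
    (h : HasCharFunDecay p c μ) (hc : 0 < c) (hp : 1 < p) :
    HasCharFunDecay (p + 1) (2 ^ (p + 1) * c ^ (1 + 1 / p) * (p / (p - 1))) (quicksortS μ) := by
  intro t ht
  refine (norm_charFun_quicksortS_le_of_decay h hc.le (by linarith) ht).trans ?_
  refine (mul_le_mul_of_nonneg_left (mul_le_mul_of_nonneg_left
    (integral_norm_charFun_le_of_one_lt h hc hp (T := t / 2) (by positivity))
    (by positivity)) (by positivity)).trans (le_of_eq ?_)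
  rw [Real.div_rpow ht.le zero_le_two, Real.rpow_neg zero_le_two, div_inv_eq_mul,
    Real.rpow_add zero_lt_two, Real.rpow_one, Real.rpow_add hc, Real.rpow_one,
    show -(p + 1) = -p + -1 by ring, Real.rpow_add ht, Real.rpow_neg_one]
  ring

theorem HasCharFunDecay.quicksortS_half {μ : Measure ℝ} [IsProbabilityMeasure μ]
    (h : HasCharFunDecay (1 / 2) 2 μ) :
    HasCharFunDecay 1 (4 * Real.pi) (quicksortS μ) := by
  intro t ht
  refine (norm_charFun_quicksortS_le_integral μ t).trans ?_
  -- The two decay bounds multiply to 4/(t√(u(1-u))), whose integral is the arcsine integral 4π/t.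
  -- This form of the fundamental theorem needs the derivative only on the open interval, so the
  -- endpoint singularities are harmless.
  have key := intervalIntegral.integral_le_sub_of_hasDeriv_right_of_le (zero_le_one (α := ℝ))
    (g := fun u => 4 / t * Real.arcsin (2 * u - 1))
    (g' := fun u => 4 / t * (1 / √(1 - (2 * u - 1) ^ 2) * 2))
    (φ := fun u => ‖charFun μ (u * t)‖ * ‖charFun μ ((1 - u) * t)‖)
    (by have := Real.continuous_arcsin; fun_prop) ?_
    ((continuous_norm_charFun_mul μ t).integrableOn_Icc) ?_
  · refine key.trans (le_of_eq ?_)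
    norm_num [Real.rpow_neg_one]
    ring
  · intro u hu
    have h1 : HasDerivAt (fun u : ℝ => 2 * u - 1) 2 u := by
      simpa using ((hasDerivAt_id u).const_mul 2).sub_const 1
    exact (((Real.hasDerivAt_arcsin (by linarith [hu.1]) (by linarith [hu.2])).comp u
      h1).const_mul (4 / t)).hasDerivWithinAt
  · intro u hu
    have hu0 : 0 < u := hu.1
    have hu1 : 0 < 1 - u := by linarith [hu.2]
    have e : ∀ x : ℝ, 0 < x → x ^ (-(1 / 2) : ℝ) = (√x)⁻¹ := fun x hx => by
      rw [Real.rpow_neg hx.le, ← Real.sqrt_eq_rpow]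
    have a1 := h (u * t) (by positivity)
    have a2 := h ((1 - u) * t) (by positivity)
    rw [e _ (by positivity)] at a1 a2
    refine (mul_le_mul a1 a2 (norm_nonneg _) (by positivity)).trans (le_of_eq ?_)
    have e2 : √(1 - (2 * u - 1) ^ 2) = 2 * (√u * √(1 - u)) := by
      rw [← Real.sqrt_mul hu0.le, show 1 - (2 * u - 1) ^ 2 = 2 ^ 2 * (u * (1 - u)) by ring,
        Real.sqrt_mul (by positivity), Real.sqrt_sq zero_le_two]
    have q0 : √u ≠ 0 := (Real.sqrt_pos.2 hu0).ne'
    have q1 : √(1 - u) ≠ 0 := (Real.sqrt_pos.2 hu1).ne'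
    have q2 : √t ≠ 0 := (Real.sqrt_pos.2 ht).ne'
    rw [e2, Real.sqrt_mul hu0.le, Real.sqrt_mul hu1.le]
    nth_rewrite 3 [← Real.mul_self_sqrt ht.le]
    field_simp
    norm_num

/-- At p = 1 the remaining integral grows logarithmically. The logarithm is traded for √t, so that
only half a power is gained. For t ≤ 8π the trivial bound 1 is already below 155 t^(-3/2). -/
theorem HasCharFunDecay.quicksortS_one {μ : Measure ℝ} [IsProbabilityMeasure μ]
    (h : HasCharFunDecay 1 (4 * Real.pi) μ) :
    HasCharFunDecay (3 / 2) 155 (quicksortS μ) := by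
  intro t ht
  have hcf : Continuous (charFun μ) := continuous_charFun
  have hi : ∀ a b, IntervalIntegrable (fun s => ‖charFun μ s‖) volume a b :=
    fun a b => hcf.norm.intervalIntegrable a b
  have e32 : t ^ (-(3 / 2) : ℝ) = (t * √t)⁻¹ := by
    rw [Real.rpow_neg ht.le, show (3 / 2 : ℝ) = 1 + 1 / 2 by norm_num, Real.rpow_add ht,
      Real.rpow_one, Real.sqrt_eq_rpow]
  have hst : 0 < √t := Real.sqrt_pos.2 ht
  rw [e32]
  set a := 4 * Real.pi with ha
  have ha0 : 0 < a := by positivity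
  have ha1 : a < 12.5664 := by have := Real.pi_lt_d6; rw [ha]; linarith
  rcases le_total (t / 2) a with hta | hta
  · refine (norm_charFun_le_one t).trans ?_
    rw [← div_eq_mul_inv, one_le_div (by positivity)]
    have h1 : t ≤ 26 := by linarith
    have h2 : √t ≤ 5.1 := Real.sqrt_le_iff.2 ⟨by norm_num, by norm_num; linarith⟩
    nlinarith
  · refine (norm_charFun_quicksortS_le_of_decay h ha0.le zero_le_one ht).trans ?_
    have h1 : ∫ s in (0 : ℝ)..a, ‖charFun μ s‖ ≤ a := by
      have := intervalIntegral.integral_mono_on ha0.le (hi 0 a)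
        (intervalIntegrable_const (c := (1 : ℝ))) fun s _ => norm_charFun_le_one s
      simpa using this
    have h0 : (0 : ℝ) ∉ Set.uIcc a (t / 2) := by
      rw [Set.uIcc_of_le hta]; exact fun H => absurd H.1 (not_le.2 ha0)
    have h2 : ∫ s in a..(t / 2), ‖charFun μ s‖ ≤ ∫ s in a..(t / 2), a * s⁻¹ := by
      refine intervalIntegral.integral_mono_on hta (hi a _)
        ((intervalIntegral.intervalIntegrable_inv (fun x hx H => h0 (H ▸ hx))
          continuousOn_id).const_mul a) fun s hs => ?_
      have := h s (ha0.trans_le hs.1)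
      rwa [Real.rpow_neg_one] at this
    rw [intervalIntegral.integral_const_mul, integral_inv h0] at h2
    set x := t / 2 / a with hx
    have hx0 : 0 < x := by positivity
    have htx : t = 2 * a * x := by rw [hx]; field_simp
    -- The sharp comparison, with equality at log x = 1.
    have h3 : 1 + Real.log x ≤ 2 * √x * Real.exp (-(1 / 2)) := by
      have := Real.add_one_le_exp ((Real.log x - 1) / 2)
      rw [show (Real.log x - 1) / 2 = Real.log x / 2 + -(1 / 2) by ring, Real.exp_add,
        Real.exp_half, Real.exp_log hx0] at this
      linarith
    have h4 : Real.exp (-(1 / 2)) ≤ 0.6066 := by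
      have := Real.exp_one_gt_d9
      rw [Real.exp_neg, Real.exp_half, ← one_div, div_le_iff₀ (by positivity)]
      have h5 : 1.6487 ≤ √(Real.exp 1) := Real.le_sqrt_of_sq_le (by norm_num; linarith)
      linarith
    have h5 : ∫ s in (0 : ℝ)..(t / 2), ‖charFun μ s‖ ≤ a * (1.2132 * √x) := by
      rw [← intervalIntegral.integral_add_adjacent_intervals (hi 0 a) (hi a (t / 2))]
      refine (add_le_add h1 h2).trans ?_
      rw [show a + a * Real.log x = a * (1 + Real.log x) by ring]
      refine mul_le_mul_of_nonneg_left (h3.trans ?_) ha0.le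
      nlinarith [Real.sqrt_nonneg x]
    refine (mul_le_mul_of_nonneg_left (mul_le_mul_of_nonneg_left h5 (by positivity))
      (by positivity)).trans ?_
    have h6 : √t = √(2 * a) * √x := by rw [htx, Real.sqrt_mul (by positivity)]
    have h7 : 4.8528 * a ^ 2 ≤ 155 * √(2 * a) := by
      refine abs_le_of_sq_le_sq' ?_ (by positivity) |>.2
      rw [mul_pow 155, Real.sq_sqrt (by positivity)]
      have : a ^ 3 ≤ 12.5664 ^ 3 := pow_le_pow_left₀ ha0.le ha1.le 3
      nlinarith
    rw [Real.rpow_neg_one, ← div_eq_mul_inv 155, le_div_iff₀ (by positivity), h6]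
    have hxx : √x * √x = x := Real.mul_self_sqrt hx0.le
    calc 2 * (a * (t / 2)⁻¹) * (t⁻¹ * (a * (1.2132 * √x))) * (t * (√(2 * a) * √x))
        = 4.8528 * a ^ 2 * √(2 * a) * (√x * √x) / t := by field_simp; norm_num
      _ = 4.8528 * a ^ 2 * √(2 * a) / (2 * a) := by rw [hxx, htx]; field_simp
      _ ≤ 155 * √(2 * a) * √(2 * a) / (2 * a) := by gcongr
      _ = 155 := by
        rw [mul_assoc, Real.mul_self_sqrt (by positivity)]; field_simp

theorem UniformCharFunDecay.of_forall_step {m : ℕ} {p c p' c' : ℝ} (h : UniformCharFunDecay m p c)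
    (hstep : ∀ μ : Measure ℝ, IsProbabilityMeasure μ → HasCharFunDecay p c μ →
      HasCharFunDecay p' c' (quicksortS μ)) : UniformCharFunDecay (m + 1) p' c' := by
  intro μ hμ n hn
  obtain ⟨n, rfl⟩ : ∃ k, n = k + 1 := ⟨n - 1, by omega⟩
  rw [Function.iterate_succ_apply']
  exact hstep _ inferInstance (h μ hμ n (by omega))

theorem UniformCharFunDecay.mono {m : ℕ} {p c c' : ℝ} (h : UniformCharFunDecay m p c)
    (hc : c ≤ c') : UniformCharFunDecay m p c' := fun μ hμ n hn => (h μ hμ n hn).mono hc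

theorem UniformCharFunDecay.interpolate {m : ℕ} {p q c : ℝ} (h : UniformCharFunDecay m p c)
    (hc : 0 < c) (hq : 0 < q) (hqp : q ≤ p) : UniformCharFunDecay m q (c ^ (q / p)) :=
  fun μ hμ n hn => (h μ hμ n hn).interpolate hc hq hqp

theorem uniformCharFunDecay_half : UniformCharFunDecay 1 (1 / 2) 2 := by
  intro μ hμ n hn
  obtain ⟨n, rfl⟩ : ∃ k, n = k + 1 := ⟨n - 1, by omega⟩
  rw [Function.iterate_succ_apply']
  exact hasCharFunDecay_half_quicksortS _

theorem uniformCharFunDecay_one : UniformCharFunDecay 2 1 (4 * Real.pi) :=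
  uniformCharFunDecay_half.of_forall_step fun _ _ h => h.quicksortS_half

theorem uniformCharFunDecay_three_half : UniformCharFunDecay 3 (3 / 2) 155 :=
  uniformCharFunDecay_one.of_forall_step fun _ _ h => h.quicksortS_one

theorem UniformCharFunDecay.succ {m : ℕ} {p c : ℝ} (h : UniformCharFunDecay m p c)
    (hc : 0 < c) (hp : 1 < p) :
    UniformCharFunDecay (m + 1) (p + 1) (2 ^ (p + 1) * c ^ (1 + 1 / p) * (p / (p - 1))) :=
  h.of_forall_step fun _ _ h => h.quicksortS_of_one_lt hc hp

/-! ### Explicit decay constants and existence of c_p -/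

/-- Turns a numerical bound on a rational power into a comparison of integer powers, which
`norm_num` can decide. -/
theorem rpow_div_le_of_pow_le {x y : ℝ} {k m : ℕ} (hx : 0 ≤ x) (hy : 0 ≤ y) (hm : m ≠ 0)
    (h : x ^ k ≤ y ^ m) : x ^ ((k : ℝ) / m) ≤ y := by
  rw [div_eq_mul_inv, Real.rpow_mul hx, Real.rpow_natCast]
  refine (Real.rpow_le_rpow (by positivity) h (by positivity)).trans (le_of_eq ?_)
  exact Real.pow_rpow_inv_natCast hy hm

/-- Two unit steps from exponent 3/2, the constants rounded up along 155, 77000, 132000000. -/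
theorem uniformCharFunDecay_seven_half : UniformCharFunDecay 5 (7 / 2) 132000000 := by
  have h1 : UniformCharFunDecay 4 (5 / 2) 77000 := by
    have := uniformCharFunDecay_three_half.succ (by norm_num) (by norm_num)
    norm_num at this
    refine this.mono ?_
    have a1 : (2 : ℝ) ^ (5 / 2 : ℝ) ≤ 5.657 := by
      have := rpow_div_le_of_pow_le (x := 2) (y := 5.657) (k := 5) (m := 2) (by norm_num)
        (by norm_num) (by norm_num) (by norm_num)
      simpa using this
    have a2 : (155 : ℝ) ^ (5 / 3 : ℝ) ≤ 4500 := by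
      have := rpow_div_le_of_pow_le (x := 155) (y := 4500) (k := 5) (m := 3) (by norm_num)
        (by norm_num) (by norm_num) (by norm_num)
      simpa using this
    have := mul_le_mul a1 a2 (by positivity) (by norm_num)
    linarith
  have := h1.succ (by norm_num) (by norm_num)
  norm_num at this
  refine this.mono ?_
  have a1 : (2 : ℝ) ^ (7 / 2 : ℝ) ≤ 11.32 := by
    have := rpow_div_le_of_pow_le (x := 2) (y := 11.32) (k := 7) (m := 2) (by norm_num)
      (by norm_num) (by norm_num) (by norm_num)
    simpa using this
  have a2 : (77000 : ℝ) ^ (7 / 5 : ℝ) ≤ 6950000 := by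
    have := rpow_div_le_of_pow_le (x := 77000) (y := 6950000) (k := 7) (m := 5) (by norm_num)
      (by norm_num) (by norm_num) (by norm_num)
    simpa using this
  have := mul_le_mul a1 a2 (by positivity) (by norm_num)
  linarith

/-- Explicit decay constants at half-integer exponents `p`. -/
noncomputable def decayConst (p : ℝ) : ℝ :=
  2 ^ (p ^ 2 + 6 * p) * Real.exp (-((2 * p - 1) / (2 * (p - 1))))

theorem decayConst_pos (p : ℝ) : 0 < decayConst p := by unfold decayConst; positivity

/-- After p/(p-1) is replaced by the larger e^(1/(p-1)), the recursion is solved exactly by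
`decayConst`: p² + 6p absorbs the factor 2^(p+1), and the exponential factor absorbs e^(1/(p-1)). -/
theorem decayConst_succ_ge {p : ℝ} (hp : 1 < p) :
    2 ^ (p + 1) * decayConst p ^ (1 + 1 / p) * (p / (p - 1)) ≤ decayConst (p + 1) := by
  have hp0 : 0 < p - 1 := by linarith
  have hpp : 0 < p := by linarith
  have h1 : p / (p - 1) ≤ Real.exp (1 / (p - 1)) := by
    have := Real.add_one_le_exp (1 / (p - 1))
    refine le_trans (le_of_eq ?_) this
    field_simp
    ring
  refine (mul_le_mul_of_nonneg_left h1
    (mul_pos (by positivity) (Real.rpow_pos_of_pos (decayConst_pos p) _)).le).trans (le_of_eq ?_)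
  unfold decayConst
  rw [Real.mul_rpow (by positivity) (by positivity), ← Real.rpow_mul zero_le_two,
    ← Real.exp_mul, ← mul_assoc, ← Real.rpow_add zero_lt_two, mul_assoc, ← Real.exp_add]
  congr 2
  · field_simp
    ring
  · have : p + 1 - 1 ≠ 0 := by linarith
    field_simp
    ring

theorem uniformCharFunDecay_decayConst (k : ℕ) :
    UniformCharFunDecay (k + 3) (k + 3 / 2) (decayConst (k + 3 / 2)) := by
  induction k with
  | zero =>
    simp only [zero_add, Nat.cast_zero]
    refine uniformCharFunDecay_three_half.mono ?_
    unfold decayConst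
    have h1 : (2 : ℝ) ^ (11 : ℝ) ≤ 2 ^ ((3 / 2 : ℝ) ^ 2 + 6 * (3 / 2)) :=
      Real.rpow_le_rpow_of_exponent_le (by norm_num) (by norm_num)
    have h2 : 0.13 ≤ Real.exp (-((2 * (3 / 2) - 1) / (2 * (3 / 2 - 1)))) := by
      norm_num
      rw [Real.exp_neg, le_inv_comm₀ (by norm_num) (by positivity),
        show (2 : ℝ) = 1 + 1 by norm_num, Real.exp_add]
      have := Real.exp_one_lt_d9
      have := Real.exp_pos 1
      nlinarith
    refine le_trans ?_ (mul_le_mul h1 h2 (by norm_num) (by positivity))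
    norm_num
  | succ k ih =>
    have hk : (0 : ℝ) ≤ k := k.cast_nonneg
    have := ih.succ (decayConst_pos _) (by linarith)
    have h2 := this.mono (decayConst_succ_ge (by linarith))
    push_cast
    rw [show (k : ℝ) + 1 + 3 / 2 = k + 3 / 2 + 1 by ring]
    exact h2

/-- Exponent 1 after two steps is weakened to p/2 < 1, doubled to p in (1, 2) by the third step, and
then raised by 1 per step. -/
theorem exists_uniformCharFunDecay_add {p : ℝ} (hp : 1 < p) (hp2 : p < 2) (k : ℕ) :
    ∃ c, 0 < c ∧ UniformCharFunDecay (k + 3) (p + k) c := by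
  induction k with
  | zero =>
    have h1 := uniformCharFunDecay_one.interpolate (by positivity) (q := p / 2) (by linarith)
      (by linarith)
    have hc : 0 < (4 * Real.pi) ^ (p / 2 / 1) := by positivity
    have h2 := h1.of_forall_step fun μ hμ h =>
      h.quicksortS_of_lt_one hc (by linarith) (by linarith)
    have hp' : 0 < 1 - p / 2 := by linarith
    refine ⟨_, ?_, by simpa [mul_div_cancel₀] using h2⟩
    positivity
  | succ k ih =>
    obtain ⟨c, hc, h⟩ := ih
    have hk : (0 : ℝ) ≤ k := k.cast_nonneg
    have h1 : 1 < p + k := by linarith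
    have h2 : 0 < p + k - 1 := by linarith
    refine ⟨_, ?_, by simpa [add_assoc] using h.succ hc h1⟩
    positivity

theorem UniformCharFunDecay.isCharFunConst {m : ℕ} {p c : ℝ} (h : UniformCharFunDecay m p c)
    (hc : 0 < c) (hm : ∀ n : ℕ, p + 1 < n → m ≤ n) : IsCharFunConst p c := by
  refine ⟨hc, fun μ hμ n hn t ht => ?_⟩
  rw [← norm_charFun_abs]
  exact h μ hμ n (hm n hn) _ (abs_pos.2 ht)

theorem exists_isCharFunConst {p : ℝ} (hp : 1 < p) : ∃ c, IsCharFunConst p c := by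
  set k := ⌊p⌋₊ with hk
  have hk1 : 1 ≤ k := Nat.le_floor (by simpa using hp.le)
  have hkp : (k : ℝ) ≤ p := Nat.floor_le (by linarith)
  have hpk : p < k + 1 := Nat.lt_floor_add_one p
  obtain ⟨j, hj⟩ : ∃ j, k = j + 1 := ⟨k - 1, by omega⟩
  have hj' : (k : ℝ) = j + 1 := by rw [hj]; push_cast; rfl
  -- For integral p the base exponent p - j would be the excluded value 1. Hence the midpoint of p
  -- and k + 1 is reached instead, also in j + 3 = k + 2 steps, and interpolated down to p; n > p +
  -- 1 forces n ≥ k + 2.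
  obtain ⟨c, hc, h⟩ := exists_uniformCharFunDecay_add (p := (p + k + 1) / 2 - j)
    (by linarith) (by linarith) j
  refine ⟨_, (h.interpolate hc (q := p) (by linarith) (by linarith)).isCharFunConst
    (by positivity) fun n hn => ?_⟩
  have : (k : ℝ) + 1 < n := by linarith
  have : k + 1 < n := by exact_mod_cast this
  omega

theorem IsCharFunConst.hasCharFunDecay {p c : ℝ} (h : IsCharFunConst p c)
    (μ : Measure ℝ) [IsProbabilityMeasure μ] {n : ℕ} (hn : p + 1 < n) :
    HasCharFunDecay p c (quicksortS^[n] μ) := by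
  intro t ht
  have := h.2 μ inferInstance n hn t ht.ne'
  rwa [abs_of_pos ht] at this

/-! ### Contraction of S in the metric sup |φ_μ - φ_ν|/t² -/

theorem norm_exp_mul_I_sub_one_sub_le (x : ℝ) :
    ‖Complex.exp (x * Complex.I) - 1 - x * Complex.I‖ ≤ x ^ 2 / 2 := by
  have key : ∀ y : ℝ, 0 ≤ y → ‖Complex.exp (y * Complex.I) - 1 - y * Complex.I‖ ≤ y ^ 2 / 2 := by
    intro y hy
    have h1 : ∀ s ∈ Set.uIcc 0 y, HasDerivAt
        (fun s : ℝ => Complex.exp (s * Complex.I) - 1 - s * Complex.I)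
        (Complex.I * (Complex.exp (s * Complex.I) - 1)) s := by
      intro s _
      have h2 : HasDerivAt (fun s : ℝ => (s : ℂ) * Complex.I) Complex.I s := by
        simpa using (HasDerivAt.ofReal_comp (hasDerivAt_id s)).mul_const Complex.I
      refine ((h2.cexp.sub_const 1).sub h2).congr_deriv ?_
      ring
    have h3 := intervalIntegral.integral_eq_sub_of_hasDerivAt h1
      (Continuous.intervalIntegrable (by fun_prop) _ _)
    have h4 : ‖∫ s in (0 : ℝ)..y, Complex.I * (Complex.exp (s * Complex.I) - 1)‖ ≤
        ∫ s in (0 : ℝ)..y, s := by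
      refine intervalIntegral.norm_integral_le_of_norm_le hy
        (Filter.Eventually.of_forall fun s hs => ?_) intervalIntegral.intervalIntegrable_id
      rw [norm_mul, Complex.norm_I, one_mul, mul_comm]
      exact (Real.norm_exp_I_mul_ofReal_sub_one_le).trans
        (by rw [Real.norm_of_nonneg hs.1.le])
    rw [h3] at h4
    simpa using h4
  rcases le_total 0 x with hx | hx
  · exact key x hx
  · have := key (-x) (by linarith)
    rw [← RCLike.norm_conj, neg_sq] at this
    refine le_trans (le_of_eq ?_) this
    congr 1
    simp [← Complex.exp_conj]
    ring

theorem norm_charFun_sub_one_le {μ : Measure ℝ} [IsProbabilityMeasure μ]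
    (h2 : MemLp (fun x : ℝ => x) 2 μ) (h0 : ∫ x, x ∂μ = 0) (t : ℝ) :
    ‖charFun μ t - 1‖ ≤ variance (fun x : ℝ => x) μ / 2 * t ^ 2 := by
  have hi1 : Integrable (fun x : ℝ => x) μ := h2.integrable (by norm_num)
  have hi2 : Integrable (fun x : ℝ => x ^ 2) μ := h2.integrable_sq
  have hv : variance (fun x : ℝ => x) μ = ∫ x, x ^ 2 ∂μ := by
    rw [variance_of_integral_eq_zero aemeasurable_id' h0]
  have hiC : Integrable (fun x : ℝ => ((t * x : ℝ) : ℂ) * Complex.I) μ :=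
    ((hi1.const_mul t).ofReal).mul_const _
  have hie : Integrable (fun x : ℝ => Complex.exp ((t * x : ℝ) * Complex.I)) μ := by
    refine Integrable.of_bound (Measurable.aestronglyMeasurable (by fun_prop)) 1 ?_
    exact Filter.Eventually.of_forall fun x => (Complex.norm_exp_ofReal_mul_I _).le
  have e : charFun μ t - 1 = ∫ x : ℝ, (Complex.exp ((t * x : ℝ) * Complex.I) - 1 -
      (t * x : ℝ) * Complex.I) ∂μ := by
    have hz : ∫ x : ℝ, ((t * x : ℝ) : ℂ) * Complex.I ∂μ = 0 := by
      rw [integral_mul_const, integral_complex_ofReal, integral_const_mul, h0]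
      simp
    rw [integral_sub (f := fun x : ℝ => Complex.exp ((t * x : ℝ) * Complex.I) - 1)
      (hie.sub (integrable_const 1)) hiC, integral_sub hie (integrable_const 1),
      hz, charFun_apply_real]
    simp
  rw [e, hv]
  refine (norm_integral_le_of_norm_le (hi2.const_mul (t ^ 2 / 2))
    (Filter.Eventually.of_forall fun x => ?_)).trans (le_of_eq ?_)
  · refine (norm_exp_mul_I_sub_one_sub_le _).trans (le_of_eq (by ring))
  · rw [integral_const_mul]; ring

/-- Telescoping the product of two characteristic functions bounds the integrand by D t²(u² +
(1-u)²), and ∫₀¹ (u² + (1-u)²) du = 2/3. -/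
theorem norm_charFun_quicksortS_sub_le {μ ν : Measure ℝ} [IsProbabilityMeasure μ]
    [IsProbabilityMeasure ν] {D : ℝ} (h : ∀ t, ‖charFun μ t - charFun ν t‖ ≤ D * t ^ 2) (t : ℝ) :
    ‖charFun (quicksortS μ) t - charFun (quicksortS ν) t‖ ≤ 2 / 3 * D * t ^ 2 := by
  have hμ : Continuous (charFun μ) := continuous_charFun
  have hν : Continuous (charFun ν) := continuous_charFun
  have hg := continuous_quicksortG
  rw [charFun_quicksortS, charFun_quicksortS, ← intervalIntegral.integral_sub
    (Continuous.intervalIntegrable (by fun_prop) _ _)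
    (Continuous.intervalIntegrable (by fun_prop) _ _)]
  have e : ∫ u in (0 : ℝ)..1, D * t ^ 2 * (u ^ 2 + (1 - u) ^ 2) = 2 / 3 * D * t ^ 2 := by
    have : ∀ u : ℝ, u ^ 2 + (1 - u) ^ 2 = 2 * u ^ 2 - 2 * u + 1 := fun u => by ring
    simp_rw [this]
    rw [intervalIntegral.integral_const_mul, intervalIntegral.integral_add, intervalIntegral.integral_sub,
      intervalIntegral.integral_const_mul, intervalIntegral.integral_const_mul, integral_pow,
      integral_id, intervalIntegral.integral_const]
    · norm_num; ring
    all_goals exact Continuous.intervalIntegrable (by fun_prop) _ _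
  rw [← e]
  refine intervalIntegral.norm_integral_le_of_norm_le zero_le_one
    (Filter.Eventually.of_forall fun u _ => ?_)
    (Continuous.intervalIntegrable (by fun_prop) _ _)
  rw [← sub_mul, norm_mul, ← Complex.ofReal_mul, Complex.norm_exp_ofReal_mul_I, mul_one]
  have e2 : charFun μ (u * t) * charFun μ ((1 - u) * t) -
      charFun ν (u * t) * charFun ν ((1 - u) * t) =
      (charFun μ (u * t) - charFun ν (u * t)) * charFun μ ((1 - u) * t) +
      charFun ν (u * t) * (charFun μ ((1 - u) * t) - charFun ν ((1 - u) * t)) := by ring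
  rw [e2]
  refine (norm_add_le _ _).trans ?_
  rw [norm_mul, norm_mul]
  have a1 : ‖charFun μ (u * t) - charFun ν (u * t)‖ * ‖charFun μ ((1 - u) * t)‖ ≤
      D * (u * t) ^ 2 * 1 := by
    gcongr
    · exact (norm_nonneg _).trans (h _)
    · exact h _
    · exact norm_charFun_le_one _
  have a2 : ‖charFun ν (u * t)‖ * ‖charFun μ ((1 - u) * t) - charFun ν ((1 - u) * t)‖ ≤
      1 * (D * ((1 - u) * t) ^ 2) := by
    gcongr
    · exact norm_charFun_le_one _
    · exact h _
  linarith

theorem norm_charFun_iterate_quicksortS_sub_le {μ ν : Measure ℝ} [IsProbabilityMeasure μ]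
    [IsProbabilityMeasure ν] {D : ℝ} (h : ∀ t, ‖charFun μ t - charFun ν t‖ ≤ D * t ^ 2) (n : ℕ)
    (t : ℝ) : ‖charFun (quicksortS^[n] μ) t - charFun (quicksortS^[n] ν) t‖ ≤
      (2 / 3) ^ n * D * t ^ 2 := by
  induction n generalizing t with
  | zero => simpa using h t
  | succ n ih =>
    rw [Function.iterate_succ_apply', Function.iterate_succ_apply']
    refine (norm_charFun_quicksortS_sub_le ih t).trans (le_of_eq ?_)
    rw [pow_succ]; ring

theorem norm_charFun_sub_le_of_mean_zero {μ ν : Measure ℝ} [IsProbabilityMeasure μ]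
    [IsProbabilityMeasure ν] (h2 : MemLp (fun x : ℝ => x) 2 μ) (h0 : ∫ x, x ∂μ = 0)
    (h2' : MemLp (fun x : ℝ => x) 2 ν) (h0' : ∫ x, x ∂ν = 0) (t : ℝ) :
    ‖charFun μ t - charFun ν t‖ ≤ quicksortA μ ν ^ 2 / 2 * t ^ 2 := by
  have h1 := norm_charFun_sub_one_le h2 h0 t
  have h3 := norm_charFun_sub_one_le h2' h0' t
  rw [quicksortA, Real.sq_sqrt (add_nonneg (variance_nonneg _ _) (variance_nonneg _ _))]
  rw [show charFun μ t - charFun ν t = (charFun μ t - 1) - (charFun ν t - 1) by ring]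
  refine (norm_sub_le _ _).trans ?_
  linarith

theorem IsQuicksortLaw.iterate {ν : Measure ℝ} (h : IsQuicksortLaw ν) (n : ℕ) :
    quicksortS^[n] ν = ν := Function.iterate_fixed h.fixed n

/-- The difference is at most 2 and at most (A²/2)(2/3)^n t², hence at most the geometric mean of
the two. The bound becomes linear in t, and 2/3 is replaced by its square root. -/
theorem norm_charFun_iterate_sub_le {μ ν : Measure ℝ} [IsProbabilityMeasure μ]
    (hν : IsQuicksortLaw ν) (h2 : MemLp (fun x : ℝ => x) 2 μ) (h0 : ∫ x, x ∂μ = 0) (n : ℕ)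
    {t : ℝ} (ht : 0 ≤ t) : ‖charFun (quicksortS^[n] μ) t - charFun ν t‖ ≤
      quicksortA μ ν * (2 / 3) ^ ((n : ℝ) / 2) * t := by
  have := hν.isProbabilityMeasure
  have h1 := norm_charFun_iterate_quicksortS_sub_le
    (norm_charFun_sub_le_of_mean_zero h2 h0 hν.memLp_two hν.mean_zero) n t
  rw [hν.iterate] at h1
  have h3 : ‖charFun (quicksortS^[n] μ) t - charFun ν t‖ ≤ 2 := by
    refine (norm_sub_le _ _).trans ?_
    linarith [norm_charFun_le_one (μ := quicksortS^[n] μ) t, norm_charFun_le_one (μ := ν) t]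
  set x := ‖charFun (quicksortS^[n] μ) t - charFun ν t‖ with hx
  have hA : 0 ≤ quicksortA μ ν := Real.sqrt_nonneg _
  have e : ((2 / 3 : ℝ) ^ ((n : ℝ) / 2)) ^ 2 = (2 / 3) ^ n := by
    rw [← Real.rpow_natCast, ← Real.rpow_mul (by norm_num), ← Real.rpow_natCast]
    congr 1
    push_cast
    ring
  refine abs_le_of_sq_le_sq' ?_ (by positivity) |>.2
  rw [mul_pow, mul_pow, e]
  nlinarith [norm_nonneg (charFun (quicksortS^[n] μ) t - charFun ν t)]

theorem IsQuicksortLaw.unique {ν ν' : Measure ℝ} (h : IsQuicksortLaw ν) (h' : IsQuicksortLaw ν') :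
    ν' = ν := by
  have := h.isProbabilityMeasure
  have := h'.isProbabilityMeasure
  refine Measure.ext_of_charFun ?_
  ext t
  have h1 := fun n => norm_charFun_iterate_quicksortS_sub_le
    (norm_charFun_sub_le_of_mean_zero h'.memLp_two h'.mean_zero h.memLp_two h.mean_zero) n t
  simp_rw [h.iterate, h'.iterate] at h1
  have h3 : Filter.Tendsto (fun n : ℕ => (2 / 3 : ℝ) ^ n * (quicksortA ν' ν ^ 2 / 2) * t ^ 2)
      Filter.atTop (nhds (0 * (quicksortA ν' ν ^ 2 / 2) * t ^ 2)) :=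
    ((tendsto_pow_atTop_nhds_zero_of_lt_one (by norm_num) (by norm_num)).mul_const _).mul_const _
  rw [zero_mul, zero_mul] at h3
  have h4 := ge_of_tendsto' h3 h1
  exact sub_eq_zero.1 (norm_le_zero_iff.1 h4)

/-! ### The integrals of g and g² -/

theorem integral_pow_succ_mul_log (k : ℕ) :
    ∫ u in (0 : ℝ)..1, u ^ (k + 1) * Real.log u = -(1 / ((k : ℝ) + 2) ^ 2) := by
  have hc : Continuous fun u : ℝ => u * Real.log u := Real.continuous_mul_log
  have h1 := intervalIntegral.integral_eq_sub_of_hasDerivAt_of_le (zero_le_one (α := ℝ))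
    (f := fun u => u ^ (k + 1) * (u * Real.log u) / (k + 2) - u ^ (k + 2) / (k + 2) ^ 2)
    (f' := fun u => u ^ (k + 1) * Real.log u) (by fun_prop) ?_ ?_
  · rw [h1]; simp
  · intro u hu
    have hu0 : u ≠ 0 := hu.1.ne'
    refine ((((hasDerivAt_pow (k + 1) u).mul (Real.hasDerivAt_mul_log hu0)).div_const
      ((k : ℝ) + 2)).sub ((hasDerivAt_pow (k + 2) u).div_const (((k : ℝ) + 2) ^ 2))).congr_deriv ?_
    have : (k : ℝ) + 2 ≠ 0 := by positivity
    simp only [Nat.add_sub_cancel, show k + 2 - 1 = k + 1 by omega]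
    push_cast
    field_simp
    ring
  · have : (fun u : ℝ => u ^ (k + 1) * Real.log u) = fun u => u ^ k * (u * Real.log u) := by
      ext u; ring
    rw [this]
    exact Continuous.intervalIntegrable (by fun_prop) _ _

theorem integral_sq_mul_log :
    ∫ u in (0 : ℝ)..1, (u * Real.log u) ^ 2 = 2 / 27 := by
  have hc : Continuous fun u : ℝ => u * Real.log u := Real.continuous_mul_log
  have h1 := intervalIntegral.integral_eq_sub_of_hasDerivAt_of_le (zero_le_one (α := ℝ))
    (f := fun u => u * (u * Real.log u) ^ 2 / 3 - 2 / 9 * u ^ 2 * (u * Real.log u)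
      + 2 / 27 * u ^ 3)
    (f' := fun u => (u * Real.log u) ^ 2) (by fun_prop) ?_ ?_
  · rw [h1]; simp
  · intro u hu
    have hu0 : u ≠ 0 := hu.1.ne'
    have hl := Real.hasDerivAt_mul_log hu0
    refine (((((hasDerivAt_id u).mul (hl.pow 2)).div_const 3).sub
      (((hasDerivAt_pow 2 u).const_mul (2 / 9)).mul hl)).add
      ((hasDerivAt_pow 3 u).const_mul (2 / 27))).congr_deriv ?_
    simp
    ring
  · exact Continuous.intervalIntegrable (by fun_prop) _ _

theorem hasSum_integral_log_mul_log_terms :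
    HasSum (fun k : ℕ => 1 / ((k : ℝ) + 1) * (1 / ((k : ℝ) + 3) ^ 2 - 1 / ((k : ℝ) + 4) ^ 2))
      (37 / 108 - Real.pi ^ 2 / 36) := by
  -- In the partial fraction expansion the simple fractions telescope. The squares, shifted to a
  -- common index, leave -1/2 + 1/3 = -1/6 times ζ(2); T collects all telescoping parts.
  set T : ℕ → ℝ := fun k => -(1 / 4) * (1 / ((k : ℝ) + 1) + 1 / ((k : ℝ) + 2)) +
    1 / 9 * (1 / ((k : ℝ) + 1) + 1 / ((k : ℝ) + 2) + 1 / ((k : ℝ) + 3)) +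
    (-(1 / 6) * (1 / ((k : ℝ) + 1)) ^ 2 - 1 / 6 * (1 / ((k : ℝ) + 2)) ^ 2 +
      1 / 3 * (1 / ((k : ℝ) + 3)) ^ 2) with hT
  have hnn : ∀ k : ℕ, 0 ≤ 1 / ((k : ℝ) + 1) *
      (1 / ((k : ℝ) + 3) ^ 2 - 1 / ((k : ℝ) + 4) ^ 2) := by
    intro k
    refine mul_nonneg (by positivity) (sub_nonneg.2 ?_)
    gcongr
    linarith
  rw [hasSum_iff_tendsto_nat_of_nonneg hnn]
  have hs : ∀ n : ℕ, ∑ k ∈ Finset.range n, 1 / ((k : ℝ) + 1) *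
      (1 / ((k : ℝ) + 3) ^ 2 - 1 / ((k : ℝ) + 4) ^ 2) =
      -(1 / 6) * ∑ k ∈ Finset.range n, 1 / ((k + 1 : ℕ) : ℝ) ^ 2 + (T n - T 0) := by
    intro n
    rw [← Finset.sum_range_sub, Finset.mul_sum, ← Finset.sum_add_distrib]
    refine Finset.sum_congr rfl fun k _ => ?_
    simp only [hT]
    push_cast
    have : (k : ℝ) + 1 ≠ 0 := by positivity
    have : (k : ℝ) + 2 ≠ 0 := by positivity
    have : (k : ℝ) + 3 ≠ 0 := by positivity
    have : (k : ℝ) + 4 ≠ 0 := by positivity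
    rw [show (k : ℝ) + 1 + 1 = k + 2 by ring, show (k : ℝ) + 1 + 2 = k + 3 by ring,
      show (k : ℝ) + 1 + 3 = k + 4 by ring]
    field_simp
    ring
  simp_rw [hs]
  have hz : Filter.Tendsto (fun n => ∑ k ∈ Finset.range n, 1 / ((k + 1 : ℕ) : ℝ) ^ 2) Filter.atTop
      (nhds (Real.pi ^ 2 / 6)) := by
    have h := (hasSum_nat_add_iff' 1).2 hasSum_zeta_two
    simpa using h.tendsto_sum_nat
  have hi : ∀ c : ℝ, Filter.Tendsto (fun n : ℕ => 1 / ((n : ℝ) + c)) Filter.atTop (nhds 0) := by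
    intro c
    simp_rw [one_div]
    exact (tendsto_natCast_atTop_atTop.atTop_add tendsto_const_nhds).inv_tendsto_atTop
  have hTl : Filter.Tendsto T Filter.atTop (nhds (-(1 / 4) * (0 + 0) + 1 / 9 * (0 + 0 + 0) +
      (-(1 / 6) * 0 ^ 2 - 1 / 6 * 0 ^ 2 + 1 / 3 * 0 ^ 2))) :=
    ((((hi 1).add (hi 2)).const_mul _).add ((((hi 1).add (hi 2)).add (hi 3)).const_mul _)).add
      (((((hi 1).pow 2).const_mul _).sub (((hi 2).pow 2).const_mul _)).add
        (((hi 3).pow 2).const_mul _))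
  have := (hz.const_mul (-(1 / 6))).add (hTl.sub_const (T 0))
  convert this using 2
  rw [hT]
  norm_num
  ring

/-- Expands -log(1-u) as a power series and integrates termwise; the terms are nonnegative on (0,
1], so summability of their integrals suffices. -/
theorem integral_log_mul_log_one_sub :
    ∫ u in (0 : ℝ)..1, (u * Real.log u) * ((1 - u) * Real.log (1 - u)) =
      37 / 108 - Real.pi ^ 2 / 36 := by
  have hc : Continuous fun u : ℝ => u * Real.log u := Real.continuous_mul_log
  set F : ℕ → ℝ → ℝ := fun k u => -(u ^ (k + 1) * (u * Real.log u) * (1 - u) / (k + 1)) with hF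
  have hFc : ∀ k, Continuous (F k) := fun k => by rw [hF]; fun_prop
  have hFnn : ∀ k, ∀ u ∈ Set.Ioc (0 : ℝ) 1, 0 ≤ F k u := by
    intro k u hu
    have h1 : u * Real.log u ≤ 0 :=
      mul_nonpos_of_nonneg_of_nonpos hu.1.le (Real.log_nonpos hu.1.le hu.2)
    have h2 : 0 ≤ 1 - u := sub_nonneg.2 hu.2
    have h3 : 0 ≤ u := hu.1.le
    have h4 : u ^ (k + 1) * (u * Real.log u) * (1 - u) / (k + 1) ≤ 0 := by
      refine div_nonpos_of_nonpos_of_nonneg ?_ (by positivity)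
      exact mul_nonpos_of_nonpos_of_nonneg
        (mul_nonpos_of_nonneg_of_nonpos (by positivity) h1) h2
    rw [hF]
    linarith
  have hFi : ∀ k : ℕ, ∫ u in Set.Ioc (0 : ℝ) 1, F k u =
      1 / ((k : ℝ) + 1) * (1 / ((k : ℝ) + 3) ^ 2 - 1 / ((k : ℝ) + 4) ^ 2) := by
    intro k
    rw [← intervalIntegral.integral_of_le zero_le_one]
    have h1 := integral_pow_succ_mul_log (k + 1)
    have h2 := integral_pow_succ_mul_log (k + 2)
    have e : ∀ u, F k u = -(1 / ((k : ℝ) + 1)) *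
        (u ^ (k + 1 + 1) * Real.log u - u ^ (k + 2 + 1) * Real.log u) := by
      intro u; rw [hF]; ring
    simp_rw [e]
    rw [intervalIntegral.integral_const_mul, intervalIntegral.integral_sub, h1, h2]
    · push_cast
      ring
    · have : (fun u : ℝ => u ^ (k + 1 + 1) * Real.log u) =
        fun u => u ^ (k + 1) * (u * Real.log u) := by ext u; ring
      rw [this]
      exact Continuous.intervalIntegrable (by fun_prop) _ _
    · have : (fun u : ℝ => u ^ (k + 2 + 1) * Real.log u) =
        fun u => u ^ (k + 2) * (u * Real.log u) := by ext u; ring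
      rw [this]
      exact Continuous.intervalIntegrable (by fun_prop) _ _
  have hint : ∀ k, Integrable (F k) (volume.restrict (Set.Ioc (0 : ℝ) 1)) := fun k =>
    (hFc k).integrableOn_Ioc
  have hs := hasSum_integral_of_summable_integral_norm hint (by
    have : ∀ k, ∫ u in Set.Ioc (0 : ℝ) 1, ‖F k u‖ = 1 / ((k : ℝ) + 1) *
        (1 / ((k : ℝ) + 3) ^ 2 - 1 / ((k : ℝ) + 4) ^ 2) := by
      intro k
      rw [← hFi]
      exact setIntegral_congr_fun measurableSet_Ioc fun u hu => Real.norm_of_nonneg (hFnn k u hu)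
    simp_rw [this]
    exact hasSum_integral_log_mul_log_terms.summable)
  simp_rw [hFi] at hs
  rw [← hs.unique hasSum_integral_log_mul_log_terms, intervalIntegral.integral_of_le zero_le_one,
    integral_Ioc_eq_integral_Ioo, integral_Ioc_eq_integral_Ioo]
  refine setIntegral_congr_fun measurableSet_Ioo fun u hu => ?_
  have h1 := (Real.hasSum_pow_div_log_of_abs_lt_one
    (show |u| < 1 by rw [abs_of_pos hu.1]; exact hu.2)).mul_left (-(u * Real.log u * (1 - u)))
  have h2 : (fun k : ℕ => -(u * Real.log u * (1 - u)) * (u ^ (k + 1) / (k + 1))) =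
      fun k => F k u := by
    ext k; rw [hF]; ring
  rw [h2] at h1
  rw [h1.tsum_eq]
  ring

theorem integral_quicksortG : ∫ u in (0 : ℝ)..1, quicksortG u = 0 := by
  have hc : Continuous fun u : ℝ => u * Real.log u := Real.continuous_mul_log
  have hc2 : Continuous fun u : ℝ => (1 - u) * Real.log (1 - u) :=
    hc.comp (continuous_const.sub continuous_id)
  have e : ∀ u, quicksortG u = 2 * (u * Real.log u) + 2 * ((1 - u) * Real.log (1 - u)) + 1 := by
    intro u; unfold quicksortG; ring
  have h1 := integral_pow_succ_mul_log 0
  simp only [zero_add, pow_one] at h1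
  have h2 := intervalIntegral.integral_comp_sub_left (a := 0) (b := 1)
    (fun u : ℝ => u * Real.log u) 1
  rw [sub_self, sub_zero, h1] at h2
  simp_rw [e]
  rw [intervalIntegral.integral_add, intervalIntegral.integral_add,
    intervalIntegral.integral_const_mul, intervalIntegral.integral_const_mul, h1, h2]
  · norm_num
  all_goals exact Continuous.intervalIntegrable (by fun_prop) _ _

theorem integral_quicksortG_sq :
    ∫ u in (0 : ℝ)..1, quicksortG u ^ 2 = (7 - 2 / 3 * Real.pi ^ 2) / 3 := by
  have hc : Continuous fun u : ℝ => u * Real.log u := Real.continuous_mul_log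
  have hc2 : Continuous fun u : ℝ => (1 - u) * Real.log (1 - u) :=
    hc.comp (continuous_const.sub continuous_id)
  have hg := continuous_quicksortG
  -- This is g² = 2g - 1 + (g-1)², where ∫g = 0 is already known.
  have e : ∀ u, quicksortG u ^ 2 = 2 * quicksortG u - 1 + 4 * (u * Real.log u) ^ 2 +
      4 * ((1 - u) * Real.log (1 - u)) ^ 2 +
      8 * ((u * Real.log u) * ((1 - u) * Real.log (1 - u))) := by
    intro u; unfold quicksortG; ring
  have h2 := intervalIntegral.integral_comp_sub_left (a := 0) (b := 1)
    (fun u : ℝ => (u * Real.log u) ^ 2) 1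
  rw [sub_self, sub_zero, integral_sq_mul_log] at h2
  simp_rw [e]
  rw [intervalIntegral.integral_add, intervalIntegral.integral_add, intervalIntegral.integral_add,
    intervalIntegral.integral_sub, intervalIntegral.integral_const_mul,
    intervalIntegral.integral_const_mul, intervalIntegral.integral_const_mul,
    intervalIntegral.integral_const_mul, integral_sq_mul_log, h2, integral_log_mul_log_one_sub,
    integral_quicksortG]
  · norm_num; ring
  all_goals exact Continuous.intervalIntegrable (by fun_prop) _ _

theorem integrable_restrict_Icc_of_continuous {f : ℝ → ℝ} (hf : Continuous f) :
    Integrable f (volume.restrict (Set.Icc (0 : ℝ) 1)) := hf.integrableOn_Icc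

theorem integral_Icc_zero_one (f : ℝ → ℝ) :
    ∫ u in Set.Icc (0 : ℝ) 1, f u = ∫ u in (0 : ℝ)..1, f u := by
  rw [integral_Icc_eq_integral_Ioc, intervalIntegral.integral_of_le zero_le_one]

/-! ### Mean and variance under S -/

section Moments

variable {μ : Measure ℝ} [IsProbabilityMeasure μ]

theorem quicksortS_mean_zero (h2 : MemLp (fun x : ℝ => x) 2 μ) (h0 : ∫ x, x ∂μ = 0) :
    ∫ x, x ∂(quicksortS μ) = 0 := by
  have hg := continuous_quicksortG
  have hi1 : Integrable (fun x : ℝ => x) μ := h2.integrable (by norm_num)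
  rw [quicksortS, integral_map measurable_quicksortS_map.aemeasurable
    (by fun_prop)]
  have i1 : Integrable (fun w : ℝ × ℝ × ℝ => w.1 * w.2.1)
      ((volume.restrict (Set.Icc (0 : ℝ) 1)).prod (μ.prod μ)) :=
    (integrable_restrict_Icc_of_continuous continuous_id).mul_prod (hi1.comp_fst μ)
  have i2 : Integrable (fun w : ℝ × ℝ × ℝ => (1 - w.1) * w.2.2)
      ((volume.restrict (Set.Icc (0 : ℝ) 1)).prod (μ.prod μ)) :=
    (integrable_restrict_Icc_of_continuous (f := fun u => 1 - u) (by fun_prop)).mul_prod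
      (hi1.comp_snd μ)
  have i3 : Integrable (fun w : ℝ × ℝ × ℝ => quicksortG w.1)
      ((volume.restrict (Set.Icc (0 : ℝ) 1)).prod (μ.prod μ)) :=
    (integrable_restrict_Icc_of_continuous hg).comp_fst _
  rw [integral_add (i1.fun_add i2) i3, integral_add i1 i2,
    integral_prod_mul (fun u : ℝ => u) (fun p : ℝ × ℝ => p.1),
    integral_prod_mul (fun u : ℝ => 1 - u) (fun p : ℝ × ℝ => p.2),
    integral_fun_fst quicksortG, integral_fun_fst (fun x : ℝ => x),
    integral_fun_snd (fun x : ℝ => x), h0, integral_Icc_zero_one quicksortG,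
    integral_quicksortG]
  simp

/-- The cross terms vanish because V and V* are centred. The resulting affine map m ↦ (2/3)m + σ²/3
has σ² as its fixed point, which identifies the variance of the limit law. -/
theorem quicksortS_second_moment (h2 : MemLp (fun x : ℝ => x) 2 μ) (h0 : ∫ x, x ∂μ = 0) :
    Integrable (fun x : ℝ => x ^ 2) (quicksortS μ) ∧
    ∫ x, x ^ 2 ∂(quicksortS μ) = 2 / 3 * ∫ x, x ^ 2 ∂μ + (7 - 2 / 3 * Real.pi ^ 2) / 3 := by
  have hg := continuous_quicksortG
  have hi1 : Integrable (fun x : ℝ => x) μ := h2.integrable (by norm_num)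
  have hi2 : Integrable (fun x : ℝ => x ^ 2) μ := h2.integrable_sq
  have hm : AEStronglyMeasurable (fun x : ℝ => x ^ 2)
      (((volume.restrict (Set.Icc (0 : ℝ) 1)).prod (μ.prod μ)).map
        (fun w : ℝ × ℝ × ℝ => w.1 * w.2.1 + (1 - w.1) * w.2.2 + quicksortG w.1)) := by fun_prop
  rw [quicksortS, integral_map measurable_quicksortS_map.aemeasurable hm,
    integrable_map_measure hm measurable_quicksortS_map.aemeasurable]
  have mk : ∀ {a : ℝ → ℝ} {b : ℝ × ℝ → ℝ}, Continuous a → Integrable b (μ.prod μ) →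
      Integrable (fun w : ℝ × ℝ × ℝ => a w.1 * b w.2)
        ((volume.restrict (Set.Icc (0 : ℝ) 1)).prod (μ.prod μ)) :=
    fun ha hb => (integrable_restrict_Icc_of_continuous ha).mul_prod hb
  have i1 := mk (a := fun u => u ^ 2) (by fun_prop) (hi2.comp_fst μ)
  have i2 := mk (a := fun u => (1 - u) ^ 2) (by fun_prop) (hi2.comp_snd μ)
  have i3 := mk (a := fun u => quicksortG u ^ 2) (b := fun _ => 1) (by fun_prop)
    (integrable_const 1)
  have i4 := mk (a := fun u => 2 * u * (1 - u)) (by fun_prop) (hi1.mul_prod hi1)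
  have i5 := mk (a := fun u => 2 * u * quicksortG u) (by fun_prop) (hi1.comp_fst μ)
  have i6 := mk (a := fun u => 2 * (1 - u) * quicksortG u) (by fun_prop) (hi1.comp_snd μ)
  have e : (fun w : ℝ × ℝ × ℝ => (w.1 * w.2.1 + (1 - w.1) * w.2.2 + quicksortG w.1) ^ 2) =
      fun w => w.1 ^ 2 * w.2.1 ^ 2 + (1 - w.1) ^ 2 * w.2.2 ^ 2 + quicksortG w.1 ^ 2 * 1 +
        2 * w.1 * (1 - w.1) * (w.2.1 * w.2.2) + 2 * w.1 * quicksortG w.1 * w.2.1 +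
        2 * (1 - w.1) * quicksortG w.1 * w.2.2 := by
    ext w; ring
  have j2 := i1.fun_add i2
  have j3 := j2.fun_add i3
  have j4 := j3.fun_add i4
  have j5 := j4.fun_add i5
  refine ⟨?_, ?_⟩
  · change Integrable (fun w : ℝ × ℝ × ℝ =>
      (w.1 * w.2.1 + (1 - w.1) * w.2.2 + quicksortG w.1) ^ 2) _
    rw [e]
    exact j5.fun_add i6
  · rw [e, integral_add j5 i6, integral_add j4 i5, integral_add j3 i4, integral_add j2 i3,
      integral_add i1 i2,
      integral_prod_mul (fun u : ℝ => u ^ 2) (fun p : ℝ × ℝ => p.1 ^ 2),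
      integral_prod_mul (fun u : ℝ => (1 - u) ^ 2) (fun p : ℝ × ℝ => p.2 ^ 2),
      integral_prod_mul (fun u : ℝ => quicksortG u ^ 2) (fun p : ℝ × ℝ => 1),
      integral_prod_mul (fun u : ℝ => 2 * u * (1 - u)) (fun p : ℝ × ℝ => p.1 * p.2),
      integral_prod_mul (fun u : ℝ => 2 * u * quicksortG u) (fun p : ℝ × ℝ => p.1),
      integral_prod_mul (fun u : ℝ => 2 * (1 - u) * quicksortG u) (fun p : ℝ × ℝ => p.2),
      integral_prod_mul (fun x : ℝ => x) (fun x : ℝ => x),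
      integral_fun_fst (fun x : ℝ => x ^ 2), integral_fun_snd (fun x : ℝ => x ^ 2),
      integral_fun_fst (fun x : ℝ => x), integral_fun_snd (fun x : ℝ => x), h0,
      integral_Icc_zero_one, integral_Icc_zero_one, integral_Icc_zero_one, integral_quicksortG_sq]
    have e1 := intervalIntegral.integral_comp_sub_left (a := 0) (b := 1) (fun u : ℝ => u ^ 2) 1
    rw [sub_self, sub_zero] at e1
    rw [e1, integral_pow]
    simp
    ring

theorem quicksortS_memLp_two (h2 : MemLp (fun x : ℝ => x) 2 μ) (h0 : ∫ x, x ∂μ = 0) :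
    MemLp (fun x : ℝ => x) 2 (quicksortS μ) :=
  (memLp_two_iff_integrable_sq (by fun_prop)).2 (quicksortS_second_moment h2 h0).1

end Moments

theorem IsQuicksortLaw.variance_eq {ν : Measure ℝ} (h : IsQuicksortLaw ν) :
    variance (fun x : ℝ => x) ν = 7 - 2 / 3 * Real.pi ^ 2 := by
  have := h.isProbabilityMeasure
  have h1 := (quicksortS_second_moment h.memLp_two h.mean_zero).2
  rw [h.fixed] at h1
  rw [variance_of_integral_eq_zero aemeasurable_id' h.mean_zero]
  linarith

/-! ### Existence of the fixed law -/

/-- Fatou's lemma for 2(1 - cos(sx))/s² → x² as s → 0, each of whose integrals is at most 2C. No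
moment is presupposed, so this applies to a law known only through its characteristic function. -/
theorem memLp_two_of_norm_charFun_sub_one_le {ν : Measure ℝ} [IsProbabilityMeasure ν] {C : ℝ}
    (h : ∀ t, ‖charFun ν t - 1‖ ≤ C * t ^ 2) : MemLp (fun x : ℝ => x) 2 ν := by
  rw [memLp_two_iff_integrable_sq (by fun_prop)]
  have hre : ∀ t, ∫ x, (1 - Real.cos (t * x)) ∂ν ≤ C * t ^ 2 := by
    intro t
    have hie : Integrable (fun x : ℝ => Complex.exp ((t * x : ℝ) * Complex.I)) ν := by
      refine Integrable.of_bound (Measurable.aestronglyMeasurable (by fun_prop)) 1 ?_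
      exact Filter.Eventually.of_forall fun x => (Complex.norm_exp_ofReal_mul_I _).le
    have e : ∫ x, (1 - Real.cos (t * x)) ∂ν = -(charFun ν t - 1).re := by
      have e1 : charFun ν t - 1 = ∫ x : ℝ, (Complex.exp ((t * x : ℝ) * Complex.I) - 1) ∂ν := by
        rw [integral_sub hie (integrable_const 1), charFun_apply_real]
        simp
      have e2 := integral_re (𝕜 := ℂ) (hie.sub (integrable_const 1))
      rw [e1]
      simp only [Pi.sub_apply, RCLike.re_eq_complex_re] at e2
      rw [← e2, ← integral_neg]
      congr 1
      ext x
      rw [Complex.sub_re, Complex.exp_ofReal_mul_I_re, Complex.one_re]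
      ring
    rw [e]
    exact (neg_le_abs _).trans ((Complex.abs_re_le_norm _).trans (h t))
  set s : ℕ → ℝ := fun n => 1 / ((n : ℝ) + 1) with hs
  have hs0 : ∀ n, 0 < s n := fun n => by simp only [hs]; positivity
  set F : ℕ → ℝ → ENNReal := fun n x => ENNReal.ofReal (2 / s n ^ 2 * (1 - Real.cos (s n * x)))
    with hF
  have hFm : ∀ n, Measurable (F n) := fun n => by simp only [hF]; fun_prop
  have hFi : ∀ n, ∫⁻ x, F n x ∂ν ≤ ENNReal.ofReal (2 * C) := by
    intro n
    have hint : Integrable (fun x => 2 / s n ^ 2 * (1 - Real.cos (s n * x))) ν := by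
      refine (Integrable.of_bound (C := 2) (by fun_prop) ?_).const_mul _
      refine Filter.Eventually.of_forall fun x => ?_
      rw [Real.norm_eq_abs, abs_le]
      constructor <;> linarith [Real.cos_le_one (s n * x), Real.neg_one_le_cos (s n * x)]
    rw [← ofReal_integral_eq_lintegral_ofReal hint]
    · refine ENNReal.ofReal_le_ofReal ?_
      rw [integral_const_mul]
      refine (mul_le_mul_of_nonneg_left (hre (s n)) (by positivity)).trans (le_of_eq ?_)
      have := (hs0 n).ne'
      field_simp
    · refine Filter.Eventually.of_forall fun x => ?_
      exact mul_nonneg (by positivity) (by linarith [Real.cos_le_one (s n * x)])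
  have hlim : ∀ x, Filter.Tendsto (fun n => F n x) Filter.atTop (nhds (ENNReal.ofReal (x ^ 2))) := by
    intro x
    refine ENNReal.tendsto_ofReal ?_
    have e : ∀ n, 2 / s n ^ 2 * (1 - Real.cos (s n * x)) =
        (x * Real.sinc (s n * x / 2)) ^ 2 := by
      intro n
      rcases eq_or_ne x 0 with rfl | hx
      · simp
      have hsx : s n * x / 2 ≠ 0 := by have := (hs0 n).ne'; positivity
      rw [Real.sinc_of_ne_zero hsx]
      have h3 : Real.cos (s n * x) = 1 - 2 * Real.sin (s n * x / 2) ^ 2 := by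
        have := Real.cos_two_mul (s n * x / 2)
        rw [show 2 * (s n * x / 2) = s n * x by ring] at this
        rw [this, Real.cos_sq']
        ring
      have := (hs0 n).ne'
      rw [h3]
      field_simp
      ring
    simp_rw [e]
    have hst : Filter.Tendsto s Filter.atTop (nhds 0) := tendsto_one_div_add_atTop_nhds_zero_nat
    have hcont : Continuous fun r : ℝ => (x * Real.sinc (r * x / 2)) ^ 2 := by
      have := Real.continuous_sinc
      fun_prop
    simpa [Function.comp_def] using (hcont.tendsto 0).comp hst
  refine ⟨by fun_prop, ?_⟩
  rw [HasFiniteIntegral]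
  have e : ∀ x : ℝ, ‖x ^ 2‖ₑ = Filter.liminf (fun n => F n x) Filter.atTop := by
    intro x
    rw [(hlim x).liminf_eq, Real.enorm_of_nonneg (sq_nonneg x)]
  simp_rw [e]
  refine (lintegral_liminf_le hFm).trans_lt ?_
  refine lt_of_le_of_lt ?_ (ENNReal.ofReal_lt_top (r := 2 * C))
  exact (Filter.liminf_le_liminf (Filter.Eventually.of_forall hFi)).trans (by simp)

/-- With a finite second moment, φ(t) - 1 - itm = O(t²); since also φ(t) - 1 = O(t²), |m| is O(t) as
t → 0. -/
theorem mean_zero_of_norm_charFun_sub_one_le {ν : Measure ℝ} [IsProbabilityMeasure ν] {C : ℝ}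
    (h : ∀ t, ‖charFun ν t - 1‖ ≤ C * t ^ 2) : ∫ x, x ∂ν = 0 := by
  have h2 := memLp_two_of_norm_charFun_sub_one_le h
  have hi1 : Integrable (fun x : ℝ => x) ν := h2.integrable (by norm_num)
  have hi2 : Integrable (fun x : ℝ => x ^ 2) ν := h2.integrable_sq
  set m := ∫ x, x ∂ν with hm
  set B := (∫ x, x ^ 2 ∂ν) / 2 with hB
  have key : ∀ t : ℝ, 0 < t → |m| ≤ (C + B) * t := by
    intro t ht
    have hiC : Integrable (fun x : ℝ => ((t * x : ℝ) : ℂ) * Complex.I) ν :=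
      ((hi1.const_mul t).ofReal).mul_const _
    have hie : Integrable (fun x : ℝ => Complex.exp ((t * x : ℝ) * Complex.I)) ν := by
      refine Integrable.of_bound (Measurable.aestronglyMeasurable (by fun_prop)) 1 ?_
      exact Filter.Eventually.of_forall fun x => (Complex.norm_exp_ofReal_mul_I _).le
    have e : charFun ν t - 1 - (t * m : ℝ) * Complex.I =
        ∫ x : ℝ, (Complex.exp ((t * x : ℝ) * Complex.I) - 1 - (t * x : ℝ) * Complex.I) ∂ν := by
      have hz : ∫ x : ℝ, ((t * x : ℝ) : ℂ) * Complex.I ∂ν = (t * m : ℝ) * Complex.I := by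
        rw [integral_mul_const, integral_complex_ofReal, integral_const_mul]
      rw [integral_sub (f := fun x : ℝ => Complex.exp ((t * x : ℝ) * Complex.I) - 1)
        (hie.sub (integrable_const 1)) hiC, integral_sub hie (integrable_const 1),
        hz, charFun_apply_real]
      simp
    have h3 : ‖charFun ν t - 1 - (t * m : ℝ) * Complex.I‖ ≤ B * t ^ 2 := by
      rw [e]
      refine (norm_integral_le_of_norm_le (hi2.const_mul (t ^ 2 / 2))
        (Filter.Eventually.of_forall fun x => ?_)).trans (le_of_eq ?_)
      · exact (norm_exp_mul_I_sub_one_sub_le _).trans (le_of_eq (by ring))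
      · rw [integral_const_mul, hB]; ring
    have h4 : ‖((t * m : ℝ) : ℂ) * Complex.I‖ ≤ (C + B) * t ^ 2 := by
      have := norm_sub_le (charFun ν t - 1) (charFun ν t - 1 - (t * m : ℝ) * Complex.I)
      rw [sub_sub_cancel] at this
      linarith [h t]
    rw [norm_mul, Complex.norm_I, mul_one, Complex.norm_real, Real.norm_eq_abs, abs_mul,
      abs_of_pos ht] at h4
    nlinarith
  have hl : Filter.Tendsto (fun t : ℝ => (C + B) * t) (nhdsWithin 0 (Set.Ioi 0)) (nhds 0) := by
    have : Continuous fun t : ℝ => (C + B) * t := by fun_prop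
    simpa using (this.tendsto 0).mono_left (nhdsWithin_le_nhds (s := Set.Ioi 0))
  have := ge_of_tendsto hl (by filter_upwards [self_mem_nhdsWithin] with t ht using key t ht)
  exact abs_nonpos_iff.1 this

/-- Lévy's continuity theorem in existence form: continuity at 0 gives tightness, Prokhorov's
theorem gives a limit along a free ultrafilter, and weak convergence identifies its characteristic
function. -/
theorem exists_probabilityMeasure_charFun_eq {μ : ℕ → Measure ℝ}
    [hμ : ∀ i, IsProbabilityMeasure (μ i)] {φ : ℝ → ℂ} (hφ : ContinuousAt φ 0)
    (h : ∀ t, Filter.Tendsto (fun n => charFun (μ n) t) Filter.atTop (nhds (φ t))) :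
    ∃ ν : Measure ℝ, IsProbabilityMeasure ν ∧ ∀ t, charFun ν t = φ t := by
  have h_tight := isTightMeasureSet_of_tendsto_charFun hφ h
  set P : ℕ → ProbabilityMeasure ℝ := fun n => ⟨μ n, hμ n⟩ with hP
  have h_compact : IsCompact (closure (Set.range P)) := by
    refine isCompact_closure_of_isTightMeasureSet ?_
    convert h_tight using 1
    ext m
    constructor
    · rintro ⟨_, ⟨n, rfl⟩, rfl⟩
      exact ⟨n, rfl⟩
    · rintro ⟨n, rfl⟩
      exact ⟨P n, ⟨n, rfl⟩, rfl⟩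
  set U : Ultrafilter ℕ := Filter.hyperfilter ℕ
  have hU : (U : Filter ℕ) ≤ Filter.atTop := Nat.hyperfilter_le_atTop
  obtain ⟨ν, -, hν⟩ := h_compact.ultrafilter_le_nhds (U.map P)
    (.trans (by simp) (Filter.monotone_principal subset_closure))
  refine ⟨ν, inferInstance, fun t => ?_⟩
  have hν' : Filter.Tendsto P U (nhds ν) := hν
  rw [ProbabilityMeasure.tendsto_iff_forall_integral_rclike_tendsto ℂ] at hν'
  have h1 := hν' (BoundedContinuousFunction.innerProbChar t)
  have h2 := (h t).mono_left hU
  refine tendsto_nhds_unique ?_ h2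
  simp_rw [charFun_eq_integral_innerProbChar]
  exact h1

/-- By contraction the characteristic functions of Sⁿδ₀ are Cauchy at each t. The limit satisfies |φ
- 1| ≤ 3Dt² (3 is the sum of the powers of 2/3), which yields continuity at 0, a finite second
moment and mean zero. -/
theorem exists_isQuicksortLaw : ∃ ν : Measure ℝ, IsQuicksortLaw ν := by
  set δ : Measure ℝ := Measure.dirac 0 with hδ
  have hd2 : MemLp (fun x : ℝ => x) 2 δ := by
    rw [memLp_two_iff_integrable_sq (by fun_prop)]
    exact integrable_dirac (by simp)
  have hd0 : ∫ x, x ∂δ = 0 := by simp [hδ]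
  have hS2 := quicksortS_memLp_two hd2 hd0
  have hS0 := quicksortS_mean_zero hd2 hd0
  set D := variance (fun x : ℝ => x) (quicksortS δ) / 2 with hD
  have hstep : ∀ t, ‖charFun δ t - charFun (quicksortS δ) t‖ ≤ D * t ^ 2 := by
    intro t
    rw [norm_sub_rev, show charFun δ t = 1 by simp [hδ]]
    exact norm_charFun_sub_one_le hS2 hS0 t
  have hgeo : ∀ t : ℝ, ∀ n : ℕ, dist (charFun (quicksortS^[n] δ) t)
      (charFun (quicksortS^[n + 1] δ) t) ≤ D * t ^ 2 * (2 / 3) ^ n := by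
    intro t n
    rw [dist_eq_norm, Function.iterate_succ_apply]
    refine (norm_charFun_iterate_quicksortS_sub_le hstep n t).trans (le_of_eq (by ring))
  have hcs := fun t => cauchySeq_of_le_geometric (2 / 3 : ℝ) (D * t ^ 2) (by norm_num) (hgeo t)
  choose φ hφ using fun t => cauchySeq_tendsto_of_complete (hcs t)
  have hdist : ∀ t n, ‖charFun (quicksortS^[n] δ) t - φ t‖ ≤ 3 * D * (2 / 3) ^ n * t ^ 2 := by
    intro t n
    rw [← dist_eq_norm]
    refine (dist_le_of_le_geometric_of_tendsto (2 / 3 : ℝ) (D * t ^ 2) (by norm_num) (hgeo t)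
      (hφ t) n).trans (le_of_eq ?_)
    field_simp
    norm_num
  have hone : ∀ t, ‖φ t - 1‖ ≤ 3 * D * t ^ 2 := by
    intro t
    have := hdist t 0
    rw [norm_sub_rev] at this
    simpa [hδ] using this
  have hφ0 : φ 0 = 1 := by
    have := hone 0
    simpa [sub_eq_zero] using this
  have hc : ContinuousAt φ 0 := by
    rw [ContinuousAt, hφ0, tendsto_iff_norm_sub_tendsto_zero]
    have : Continuous fun t : ℝ => 3 * D * t ^ 2 := by fun_prop
    exact squeeze_zero (fun _ => norm_nonneg _) hone (by simpa using this.tendsto 0)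
  obtain ⟨ν, hν, hνφ⟩ := exists_probabilityMeasure_charFun_eq hc hφ
  have hone' : ∀ t, ‖charFun ν t - 1‖ ≤ 3 * D * t ^ 2 := fun t => by rw [hνφ]; exact hone t
  refine ⟨ν, hν, memLp_two_of_norm_charFun_sub_one_le hone',
    mean_zero_of_norm_charFun_sub_one_le hone', ?_⟩
  refine Measure.ext_of_charFun ?_
  ext t
  rw [hνφ]
  have h1 : ∀ n, ‖charFun (quicksortS^[n + 1] δ) t - charFun (quicksortS ν) t‖ ≤
      2 / 3 * (3 * D * (2 / 3) ^ n) * t ^ 2 := by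
    intro n
    rw [Function.iterate_succ_apply']
    refine norm_charFun_quicksortS_sub_le (fun s => ?_) t
    rw [hνφ]
    exact hdist s n
  refine tendsto_nhds_unique (f := fun n => charFun (quicksortS^[n + 1] δ) t) ?_
    ((Filter.tendsto_add_atTop_iff_nat 1).2 (hφ t))
  rw [tendsto_iff_norm_sub_tendsto_zero]
  refine squeeze_zero (fun _ => norm_nonneg _) h1 ?_
  have h3 := (tendsto_pow_atTop_nhds_zero_of_lt_one (r := (2 / 3 : ℝ)) (by norm_num)
    (by norm_num)).const_mul (2 / 3 * (3 * D) * t ^ 2)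
  rw [mul_zero] at h3
  refine h3.congr fun n => by ring

/-! ### Fourier inversion for integrable characteristic functions -/

open scoped FourierTransform in
/-- The Fourier inversion integral of the characteristic function of `μ`. -/
noncomputable def charFunDensity (μ : Measure ℝ) (x : ℝ) : ℝ :=
  (𝓕 (fun t : ℝ => charFun μ (2 * Real.pi * t)) x).re

section Inversion

open scoped FourierTransform

theorem integrable_charFun_comp_two_pi {μ : Measure ℝ} (h : Integrable (charFun μ)) :
    Integrable (fun t : ℝ => charFun μ (2 * Real.pi * t)) :=
  h.comp_mul_left' (by positivity)

theorem integrable_exp_neg_pi_mul_sq {ε : ℝ} (hε : 0 < ε) :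
    Integrable fun t : ℝ => Real.exp (-(Real.pi * ε) * t ^ 2) :=
  integrable_exp_neg_mul_sq (by positivity)

theorem fourier_exp_neg_pi_mul_sq {ε : ℝ} (hε : 0 < ε) (z : ℝ) :
    ∫ t : ℝ, Complex.exp ((-2 * Real.pi * t * z : ℝ) * Complex.I) *
      (Real.exp (-(Real.pi * ε) * t ^ 2) : ℂ) =
      ((√ε)⁻¹ * Real.exp (-(Real.pi / ε) * z ^ 2) : ℝ) := by
  have h := congrFun (fourier_gaussian_pi (b := (ε : ℂ)) (by simpa using hε)) z
  rw [Real.fourier_real_eq_integral_exp_smul] at h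
  simp only [smul_eq_mul] at h
  have e1 : ∀ t : ℝ, Complex.exp ((-2 * Real.pi * t * z : ℝ) * Complex.I) *
      (Real.exp (-(Real.pi * ε) * t ^ 2) : ℂ) =
      Complex.exp (↑(-2 * Real.pi * t * z) * Complex.I) *
        Complex.exp (-Real.pi * ε * t ^ 2) := by
    intro t
    push_cast
    ring_nf
  simp_rw [e1]
  rw [h]
  have e2 : ((ε : ℂ)) ^ (1 / 2 : ℂ) = ((√ε : ℝ) : ℂ) := by
    rw [Real.sqrt_eq_rpow, Complex.ofReal_cpow hε.le]
    norm_num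
  rw [e2]
  push_cast
  ring_nf

theorem contDiff_charFunDensity {μ : Measure ℝ}
    (h : ∀ n : ℕ, Integrable (fun t : ℝ => ‖t‖ ^ n * ‖charFun μ (2 * Real.pi * t)‖)) :
    ContDiff ℝ ∞ (charFunDensity μ) :=
  Complex.reCLM.contDiff.comp (Real.contDiff_fourier (N := ⊤) fun n _ => h n)

theorem continuous_fourier_charFun {μ : Measure ℝ} (h : Integrable (charFun μ)) :
    Continuous (𝓕 (fun t : ℝ => charFun μ (2 * Real.pi * t))) := by
  refine (Real.contDiff_fourier (N := 0) fun n hn => ?_).continuous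
  have : n = 0 := by simpa using hn
  subst this
  simpa using (integrable_charFun_comp_two_pi h).norm

theorem norm_fourier_le (f : ℝ → ℂ) (x : ℝ) : ‖𝓕 f x‖ ≤ ∫ t, ‖f t‖ :=
  VectorFourier.norm_fourierIntegral_le_integral_norm _ _ _ _ _

theorem abs_charFunDensity_sub_le {μ ν : Measure ℝ}
    (h : Integrable (charFun μ)) (h' : Integrable (charFun ν)) (x : ℝ) :
    |charFunDensity μ x - charFunDensity ν x| ≤
      1 / (2 * Real.pi) * ∫ t, ‖charFun μ t - charFun ν t‖ := by
  have h1 := integrable_charFun_comp_two_pi h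
  have h2 := integrable_charFun_comp_two_pi h'
  have e : charFunDensity μ x - charFunDensity ν x =
      (𝓕 (fun t : ℝ => charFun μ (2 * Real.pi * t) - charFun ν (2 * Real.pi * t)) x).re := by
    rw [charFunDensity, charFunDensity, ← Complex.sub_re]
    congr 1
    simp_rw [Real.fourier_real_eq, smul_sub]
    rw [integral_sub]
    · exact (Real.fourierIntegral_convergent_iff x).2 h1 |> fun H => by simpa [mul_comm] using H
    · exact (Real.fourierIntegral_convergent_iff x).2 h2 |> fun H => by simpa [mul_comm] using H
  rw [e]
  refine (Complex.abs_re_le_norm _).trans ((norm_fourier_le _ x).trans (le_of_eq ?_))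
  have := Measure.integral_comp_mul_left (fun t => ‖charFun μ t - charFun ν t‖) (2 * Real.pi)
  rw [this, smul_eq_mul, abs_of_pos (by positivity), one_div]

variable {μ : Measure ℝ} [IsProbabilityMeasure μ]

/-- Gaussian damping on the Fourier side is convolution of μ with a Gaussian density, a manifestly
real and nonnegative function. -/
theorem fourier_charFun_mul_gaussian {ε : ℝ} (hε : 0 < ε) (x : ℝ) :
    𝓕 (fun t : ℝ => charFun μ (2 * Real.pi * t) * (Real.exp (-(Real.pi * ε) * t ^ 2) : ℂ)) x =
      (∫ y, (√ε)⁻¹ * Real.exp (-(Real.pi / ε) * (x - y) ^ 2) ∂μ : ℝ) := by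
  rw [Real.fourier_real_eq_integral_exp_smul]
  have hint : Integrable (fun z : ℝ × ℝ =>
      Complex.exp ((-2 * Real.pi * z.1 * (x - z.2) : ℝ) * Complex.I) *
      (Real.exp (-(Real.pi * ε) * z.1 ^ 2) : ℂ)) (volume.prod μ) := by
    refine ((integrable_exp_neg_pi_mul_sq hε).comp_fst μ).mono'
      (Measurable.aestronglyMeasurable (by fun_prop)) (Filter.Eventually.of_forall fun z => ?_)
    rw [norm_mul, Complex.norm_exp_ofReal_mul_I, one_mul, Complex.norm_real,
      Real.norm_of_nonneg (Real.exp_nonneg _)]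
  have h1 : ∀ t : ℝ, Complex.exp (↑(-2 * Real.pi * t * x) * Complex.I) •
      (charFun μ (2 * Real.pi * t) * (Real.exp (-(Real.pi * ε) * t ^ 2) : ℂ)) =
      ∫ y, Complex.exp ((-2 * Real.pi * t * (x - y) : ℝ) * Complex.I) *
        (Real.exp (-(Real.pi * ε) * t ^ 2) : ℂ) ∂μ := by
    intro t
    rw [charFun_apply_real, integral_mul_const, smul_eq_mul, ← mul_assoc, ← integral_const_mul]
    congr 2
    ext y
    rw [← Complex.exp_add]
    congr 1
    push_cast
    ring
  simp_rw [h1]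
  rw [integral_integral_swap hint]
  simp_rw [fourier_exp_neg_pi_mul_sq hε]
  rw [integral_complex_ofReal]

theorem lintegral_gaussian_kernel {ε : ℝ} (hε : 0 < ε) :
    ∫⁻ z : ℝ, ENNReal.ofReal ((√ε)⁻¹ * Real.exp (-(Real.pi / ε) * z ^ 2)) = 1 := by
  rw [← ofReal_integral_eq_lintegral_ofReal]
  · rw [integral_const_mul, integral_gaussian, ← Real.sqrt_inv, ← Real.sqrt_mul (by positivity)]
    have := Real.pi_pos.ne'
    rw [show ε⁻¹ * (Real.pi / (Real.pi / ε)) = 1 by field_simp]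
    simp
  · exact (integrable_exp_neg_mul_sq (by positivity)).const_mul _
  · exact Filter.Eventually.of_forall fun z => by positivity

theorem lintegral_gaussian_conv {ε : ℝ} (hε : 0 < ε) :
    ∫⁻ x : ℝ, ENNReal.ofReal (∫ y, (√ε)⁻¹ * Real.exp (-(Real.pi / ε) * (x - y) ^ 2) ∂μ) = 1 := by
  have h1 : ∀ x : ℝ, ENNReal.ofReal (∫ y, (√ε)⁻¹ * Real.exp (-(Real.pi / ε) * (x - y) ^ 2) ∂μ) =
      ∫⁻ y, ENNReal.ofReal ((√ε)⁻¹ * Real.exp (-(Real.pi / ε) * (x - y) ^ 2)) ∂μ := by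
    intro x
    refine ofReal_integral_eq_lintegral_ofReal ?_
      (Filter.Eventually.of_forall fun z => by positivity)
    refine Integrable.of_bound (Measurable.aestronglyMeasurable (by fun_prop)) (√ε)⁻¹ ?_
    refine Filter.Eventually.of_forall fun y => ?_
    rw [Real.norm_of_nonneg (by positivity)]
    refine mul_le_of_le_one_right (by positivity) (Real.exp_le_one_iff.2 ?_)
    have : 0 ≤ Real.pi / ε * (x - y) ^ 2 := by positivity
    linarith
  simp_rw [h1]
  rw [lintegral_lintegral_swap (Measurable.aemeasurable (by fun_prop))]
  have h2 : ∀ y : ℝ, ∫⁻ x : ℝ,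
      ENNReal.ofReal ((√ε)⁻¹ * Real.exp (-(Real.pi / ε) * (x - y) ^ 2)) = 1 := by
    intro y
    rw [lintegral_sub_right_eq_self
      (fun z : ℝ => ENNReal.ofReal ((√ε)⁻¹ * Real.exp (-(Real.pi / ε) * z ^ 2))) y]
    exact lintegral_gaussian_kernel hε
  simp_rw [h2]
  simp

theorem tendsto_fourier_charFun_mul_gaussian (h : Integrable (charFun μ)) (x : ℝ) :
    Filter.Tendsto (fun n : ℕ => 𝓕 (fun t : ℝ => charFun μ (2 * Real.pi * t) *
      (Real.exp (-(Real.pi * (1 / ((n : ℝ) + 1))) * t ^ 2) : ℂ)) x) Filter.atTop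
      (nhds (𝓕 (fun t : ℝ => charFun μ (2 * Real.pi * t)) x)) := by
  have hc : Continuous (charFun μ) := continuous_charFun
  simp_rw [Real.fourier_real_eq_integral_exp_smul]
  refine tendsto_integral_of_dominated_convergence
    (fun t => ‖charFun μ (2 * Real.pi * t)‖) (fun n => ?_)
    (integrable_charFun_comp_two_pi h).norm (fun n => ?_) ?_
  · exact Continuous.aestronglyMeasurable (by fun_prop)
  · refine Filter.Eventually.of_forall fun t => ?_
    rw [norm_smul, Complex.norm_exp_ofReal_mul_I, one_mul, norm_mul, Complex.norm_real,
      Real.norm_of_nonneg (Real.exp_nonneg _)]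
    refine mul_le_of_le_one_right (norm_nonneg _) (Real.exp_le_one_iff.2 ?_)
    have : 0 ≤ Real.pi * (1 / ((n : ℝ) + 1)) * t ^ 2 := by positivity
    linarith
  · refine Filter.Eventually.of_forall fun t => ?_
    have hcont : Continuous fun s : ℝ => Complex.exp (↑(-2 * Real.pi * t * x) * Complex.I) •
        (charFun μ (2 * Real.pi * t) * (Real.exp (-(Real.pi * s) * t ^ 2) : ℂ)) := by fun_prop
    have := (hcont.tendsto 0).comp (tendsto_one_div_add_atTop_nhds_zero_nat (𝕜 := ℝ))
    simpa [Function.comp_def] using this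

/-- Reality and nonnegativity pass to the limit from the Gaussian convolutions as the damping is
removed. -/
theorem fourier_charFun_eq_ofReal (h : Integrable (charFun μ)) (x : ℝ) :
    𝓕 (fun t : ℝ => charFun μ (2 * Real.pi * t)) x = (charFunDensity μ x : ℂ) ∧
      0 ≤ charFunDensity μ x ∧
      Filter.Tendsto (fun n : ℕ => ∫ y, (√(1 / ((n : ℝ) + 1)))⁻¹ *
        Real.exp (-(Real.pi / (1 / ((n : ℝ) + 1))) * (x - y) ^ 2) ∂μ) Filter.atTop
        (nhds (charFunDensity μ x)) := by
  have hl := tendsto_fourier_charFun_mul_gaussian h x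
  have hl' := hl.congr fun n : ℕ => fourier_charFun_mul_gaussian (μ := μ)
    (ε := 1 / ((n : ℝ) + 1)) (by positivity) x
  have hre := (Complex.continuous_re.tendsto _).comp hl'
  have him := (Complex.continuous_im.tendsto _).comp hl'
  simp only [Function.comp_def, Complex.ofReal_re, Complex.ofReal_im] at hre him
  refine ⟨?_, ?_, hre⟩
  · refine Complex.ext rfl ?_
    exact (tendsto_nhds_unique tendsto_const_nhds him).symm
  · refine ge_of_tendsto' hre fun n => integral_nonneg fun y => by positivity

/-- Fatou's lemma: the density is a pointwise limit of Gaussian convolutions, each of total mass 1.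
-/
theorem integrable_charFunDensity (h : Integrable (charFun μ)) :
    Integrable (charFunDensity μ) := by
  have hc : Continuous (charFunDensity μ) :=
    Complex.continuous_re.comp (continuous_fourier_charFun h)
  refine ⟨hc.aestronglyMeasurable, ?_⟩
  rw [HasFiniteIntegral]
  have e : ∀ x, ‖charFunDensity μ x‖ₑ = Filter.liminf (fun n : ℕ => ENNReal.ofReal
      (∫ y, (√(1 / ((n : ℝ) + 1)))⁻¹ *
        Real.exp (-(Real.pi / (1 / ((n : ℝ) + 1))) * (x - y) ^ 2) ∂μ)) Filter.atTop := by
    intro x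
    obtain ⟨-, h0, hl⟩ := fourier_charFun_eq_ofReal h x
    rw [(ENNReal.tendsto_ofReal hl).liminf_eq, Real.enorm_of_nonneg h0]
  simp_rw [e]
  have hm : ∀ n : ℕ, Measurable fun x : ℝ => ENNReal.ofReal
      (∫ y, (√(1 / ((n : ℝ) + 1)))⁻¹ *
        Real.exp (-(Real.pi / (1 / ((n : ℝ) + 1))) * (x - y) ^ 2) ∂μ) := by
    intro n
    refine ENNReal.measurable_ofReal.comp ?_
    refine StronglyMeasurable.measurable (StronglyMeasurable.integral_prod_right
      (f := fun x y : ℝ => (√(1 / ((n : ℝ) + 1)))⁻¹ *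
        Real.exp (-(Real.pi / (1 / ((n : ℝ) + 1))) * (x - y) ^ 2)) ?_)
    exact Measurable.stronglyMeasurable (by fun_prop)
  refine (lintegral_liminf_le hm).trans_lt ?_
  have : ∀ n : ℕ, ∫⁻ x : ℝ, ENNReal.ofReal (∫ y, (√(1 / ((n : ℝ) + 1)))⁻¹ *
        Real.exp (-(Real.pi / (1 / ((n : ℝ) + 1))) * (x - y) ^ 2) ∂μ) = 1 := fun n =>
    lintegral_gaussian_conv (by positivity)
  simp_rw [this]
  simp

/-- A law with integrable characteristic function has a bounded continuous density. -/
theorem isBddContDensity_charFunDensity (h : Integrable (charFun μ)) :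
    IsBddContDensity μ (charFunDensity μ) := by
  have hc : Continuous (charFunDensity μ) :=
    Complex.continuous_re.comp (continuous_fourier_charFun h)
  have hint := integrable_charFunDensity h
  have hnn : ∀ x, 0 ≤ charFunDensity μ x := fun x => (fourier_charFun_eq_ofReal h x).2.1
  have he : 𝓕 (fun t : ℝ => charFun μ (2 * Real.pi * t)) = fun x => (charFunDensity μ x : ℂ) :=
    funext fun x => (fourier_charFun_eq_ofReal h x).1
  refine ⟨hc, hnn, ⟨∫ t : ℝ, ‖charFun μ (2 * Real.pi * t)‖, fun x => ?_⟩, ?_⟩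
  · exact (le_abs_self _).trans ((Complex.abs_re_le_norm _).trans (norm_fourier_le _ x))
  have : IsFiniteMeasure (volume.withDensity fun x => ENNReal.ofReal (charFunDensity μ x)) :=
    isFiniteMeasure_withDensity_ofReal hint.2
  refine Measure.ext_of_charFun ?_
  ext t
  have hcont : Continuous (fun t : ℝ => charFun μ (2 * Real.pi * t)) := by
    have : Continuous (charFun μ) := continuous_charFun
    fun_prop
  -- Inverting the transform at t/(2π) returns φ_μ(t) as the characteristic function of the
  -- candidate density, and characteristic functions determine finite measures.
  have hinv := congrFun (hcont.fourierInv_fourier_eq (integrable_charFun_comp_two_pi h)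
    (he ▸ hint.ofReal)) (t / (2 * Real.pi))
  have hpi := Real.pi_pos.ne'
  rw [he, Real.fourierInv_eq'] at hinv
  rw [show 2 * Real.pi * (t / (2 * Real.pi)) = t by field_simp] at hinv
  rw [← hinv, charFun_apply_real, integral_withDensity_eq_integral_toReal_smul
    (by fun_prop) (by simp)]
  congr 1
  ext x
  rw [ENNReal.toReal_ofReal (hnn x), smul_eq_mul, Complex.real_smul, mul_comm]
  congr 2
  simp only [RCLike.inner_apply, conj_trivial]
  push_cast
  field_simp

end Inversion

/-! ### Integrals of functions with power decay -/

theorem integrable_of_norm_le_rpow {f : ℝ → ℝ} (hf : Continuous f) {p c : ℝ} (hp : 1 < p)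
    (hc : 0 ≤ c) (h1 : ∀ t, |t| ≤ 1 → |f t| ≤ 1) (h2 : ∀ t, 1 ≤ |t| → |f t| ≤ c * |t| ^ (-p)) :
    Integrable f := by
  have hint : Integrable fun t : ℝ => (2 ^ p * (1 + c)) * (1 + ‖t‖) ^ (-p) :=
    (integrable_one_add_norm (by simpa using hp)).const_mul _
  refine hint.mono' hf.aestronglyMeasurable (Filter.Eventually.of_forall fun t => ?_)
  have hpos : ∀ s : ℝ, 0 ≤ s → (2 : ℝ) ^ p * (2 * s) ^ (-p) = s ^ (-p) := by
    intro s hs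
    rw [Real.mul_rpow zero_le_two hs, ← mul_assoc, ← Real.rpow_add zero_lt_two]
    simp
  rw [Real.norm_eq_abs, Real.norm_eq_abs]
  have ht : 0 ≤ |t| := abs_nonneg t
  rcases le_total |t| 1 with h | h
  · refine (h1 t h).trans ?_
    have h3 : (2 : ℝ) ^ (-p) ≤ (1 + |t|) ^ (-p) :=
      Real.rpow_le_rpow_of_nonpos (by positivity) (by linarith) (by linarith)
    have h4 : (2 : ℝ) ^ p * 2 ^ (-p) = 1 := by
      rw [← Real.rpow_add zero_lt_two]; simp
    have h5 : 1 ≤ (2 : ℝ) ^ p * (1 + |t|) ^ (-p) :=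
      h4.symm.le.trans (mul_le_mul_of_nonneg_left h3 (by positivity))
    nlinarith
  · refine (h2 t h).trans ?_
    have h3 : (2 * |t|) ^ (-p) ≤ (1 + |t|) ^ (-p) :=
      Real.rpow_le_rpow_of_nonpos (by positivity) (by linarith) (by linarith)
    rw [← hpos |t| ht]
    have h5 : 2 ^ p * (2 * |t|) ^ (-p) ≤ (2 : ℝ) ^ p * (1 + |t|) ^ (-p) :=
      mul_le_mul_of_nonneg_left h3 (by positivity)
    have h6 : 0 ≤ (2 : ℝ) ^ p * (1 + |t|) ^ (-p) := by positivity
    nlinarith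

theorem HasCharFunDecay.norm_le {p c : ℝ} {μ : Measure ℝ} (h : HasCharFunDecay p c μ) {t : ℝ}
    (ht : t ≠ 0) : ‖charFun μ t‖ ≤ c * |t| ^ (-p) := by
  rw [← norm_charFun_abs]
  exact h _ (abs_pos.2 ht)

theorem HasCharFunDecay.integrable {p c : ℝ} {μ : Measure ℝ} [IsProbabilityMeasure μ]
    (h : HasCharFunDecay p c μ) (hc : 0 ≤ c) (hp : 1 < p) : Integrable (charFun μ) := by
  have hcf : Continuous (charFun μ) := continuous_charFun
  refine (integrable_norm_iff hcf.aestronglyMeasurable).1 ?_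
  refine integrable_of_norm_le_rpow hcf.norm hp hc (fun t _ => ?_) fun t ht => ?_
  · rw [abs_norm]; exact norm_charFun_le_one t
  · rw [abs_norm]
    exact h.norm_le (abs_pos.1 (by linarith))

theorem HasCharFunDecay.integrable_pow_mul {n : ℕ} {c : ℝ} {μ : Measure ℝ}
    [IsProbabilityMeasure μ] (h : HasCharFunDecay (n + 2) c μ) (hc : 0 ≤ c) :
    Integrable (fun t : ℝ => ‖t‖ ^ n * ‖charFun μ (2 * Real.pi * t)‖) := by
  have hcf : Continuous (charFun μ) := continuous_charFun
  refine integrable_of_norm_le_rpow (p := 2) (c := c) (by fun_prop) (by norm_num) hc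
    (fun t ht => ?_) fun t ht => ?_
  · rw [abs_of_nonneg (by positivity), Real.norm_eq_abs]
    exact mul_le_one₀ (pow_le_one₀ (abs_nonneg t) ht) (norm_nonneg _) (norm_charFun_le_one _)
  · have ht0 : 0 < |t| := by linarith
    have hpi := Real.pi_gt_three
    rw [abs_of_nonneg (by positivity), Real.norm_eq_abs]
    have h1 := h.norm_le (t := 2 * Real.pi * t)
      (mul_ne_zero (by positivity) (abs_pos.1 ht0))
    have h2 : |2 * Real.pi * t| ^ (-((n : ℝ) + 2)) ≤ |t| ^ (-((n : ℝ) + 2)) := by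
      refine Real.rpow_le_rpow_of_nonpos ht0 ?_ (by linarith [n.cast_nonneg (α := ℝ)])
      rw [abs_mul, abs_of_pos (show 0 < 2 * Real.pi by positivity)]
      nlinarith
    have h3 : |t| ^ n * |t| ^ (-((n : ℝ) + 2)) = |t| ^ (-2 : ℝ) := by
      rw [← Real.rpow_natCast, ← Real.rpow_add ht0]
      congr 1
      ring
    calc |t| ^ n * ‖charFun μ (2 * Real.pi * t)‖
        ≤ |t| ^ n * (c * |t| ^ (-((n : ℝ) + 2))) := by gcongr; exact h1.trans (by gcongr)
      _ = c * |t| ^ (-2 : ℝ) := by rw [← h3]; ring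

/-- Splitting the integral of a function bounded by `b t` near `0` and by `K t ^ (-p)` near `∞`. -/
theorem integral_le_of_le_mul_of_le_rpow {F : ℝ → ℝ} (hF : Continuous F) (hFi : Integrable F)
    (heven : ∀ t, F |t| = F t) {b K p : ℝ} (hb : 0 < b) (hK : 0 < K) (hp : 1 < p)
    (h1 : ∀ t, 0 ≤ t → F t ≤ b * t) (h2 : ∀ t, 0 < t → F t ≤ K * t ^ (-p)) :
    ∫ t, F t ≤ b * (K / b) ^ (2 / (p + 1)) * ((p + 1) / (p - 1)) := by
  -- The cut is the point where the two bounds bT and K T^(-p) agree.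
  set T := (K / b) ^ (1 / (p + 1)) with hT
  have hT0 : 0 < T := by positivity
  have hp1 : 0 < p - 1 := by linarith
  have hT2 : (K / b) ^ (2 / (p + 1)) = T ^ 2 := by
    rw [hT, ← Real.rpow_natCast, ← Real.rpow_mul (by positivity)]
    congr 1
    push_cast
    ring
  have hTp : T ^ (p + 1) = K / b := by
    rw [hT, ← Real.rpow_mul (by positivity), one_div, inv_mul_cancel₀ (by linarith), Real.rpow_one]
  have hKT : K * T ^ (-p + 1) = b * T ^ 2 := by
    have h3 : T ^ (p + 1) * T ^ (-p + 1) = T ^ 2 := by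
      rw [← Real.rpow_add hT0, ← Real.rpow_natCast]
      congr 1
      push_cast
      ring
    rw [hTp] at h3
    rw [← h3]
    field_simp
  have e : ∫ t, F t = 2 * ∫ t in Set.Ioi (0 : ℝ), F t := by
    rw [← integral_comp_abs]
    simp_rw [heven]
  have hsplit : ∫ t in Set.Ioi (0 : ℝ), F t = (∫ t in (0 : ℝ)..T, F t) + ∫ t in Set.Ioi T, F t := by
    rw [intervalIntegral.integral_of_le hT0.le, ← setIntegral_union
      (Set.Ioc_disjoint_Ioi le_rfl) measurableSet_Ioi hFi.integrableOn hFi.integrableOn,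
      Set.Ioc_union_Ioi_eq_Ioi hT0.le]
  have i1 : ∫ t in (0 : ℝ)..T, F t ≤ b * (T ^ 2 / 2) := by
    have : ∫ t in (0 : ℝ)..T, b * t = b * (T ^ 2 / 2) := by
      rw [intervalIntegral.integral_const_mul, integral_id]; ring
    rw [← this]
    exact intervalIntegral.integral_mono_on hT0.le (hF.intervalIntegrable _ _)
      (Continuous.intervalIntegrable (by fun_prop) _ _) fun t ht => h1 t ht.1
  have i2 : ∫ t in Set.Ioi T, F t ≤ b * T ^ 2 / (p - 1) := by
    have : ∫ t in Set.Ioi T, K * t ^ (-p) = b * T ^ 2 / (p - 1) := by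
      rw [integral_const_mul, integral_Ioi_rpow_of_lt (by linarith) hT0, ← hKT,
        show -p + 1 = -(p - 1) by ring]
      field_simp
    rw [← this]
    exact setIntegral_mono_on hFi.integrableOn
      ((integrableOn_Ioi_rpow_of_lt (by linarith) hT0).const_mul K) measurableSet_Ioi
      fun t ht => h2 t (hT0.trans ht)
  rw [e, hsplit, hT2]
  have : b * T ^ 2 * ((p + 1) / (p - 1)) = 2 * (b * (T ^ 2 / 2) + b * T ^ 2 / (p - 1)) := by
    field_simp
    ring
  linarith

/-- A is at least σ = 0.6483…. This numerical lower bound removes c/A from the constants below. -/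
theorem quicksortA_ge {ν : Measure ℝ} (hν : IsQuicksortLaw ν) (μ : Measure ℝ) :
    0.648 ≤ quicksortA μ ν := by
  rw [quicksortA, hν.variance_eq]
  refine Real.le_sqrt_of_sq_le ?_
  have h1 := variance_nonneg (fun x : ℝ => x) μ
  have h2 := Real.pi_lt_d4
  have h3 := Real.pi_pos
  nlinarith

/-! ### Uniform bounds on the densities -/

section Bounds

variable {μ ν : Measure ℝ} [IsProbabilityMeasure μ] {n : ℕ} {p c : ℝ}

theorem abs_charFunDensity_iterate_sub_le (hν : IsQuicksortLaw ν)
    (h2 : MemLp (fun x : ℝ => x) 2 μ) (h0 : ∫ x, x ∂μ = 0) (hp : 1 < p) (hc : 0 < c)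
    (hd : HasCharFunDecay p c (quicksortS^[n] μ)) (hd' : HasCharFunDecay p c ν) (x : ℝ) :
    |charFunDensity (quicksortS^[n] μ) x - charFunDensity ν x| ≤
      quicksortA μ ν / (2 * Real.pi) * (2 * c / quicksortA μ ν) ^ (2 / (p + 1)) *
        ((p + 1) / (p - 1)) * (2 / 3 : ℝ) ^ ((1 / 2 - 1 / (p + 1)) * (n : ℝ)) := by
  have := hν.isProbabilityMeasure
  have hA : 0 < quicksortA μ ν := lt_of_lt_of_le (by norm_num) (quicksortA_ge hν μ)
  set A := quicksortA μ ν with hAdef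
  have hi := hd.integrable hc.le hp
  have hi' := hd'.integrable hc.le hp
  refine (abs_charFunDensity_sub_le hi hi' x).trans ?_
  have hcf : Continuous (charFun (quicksortS^[n] μ)) := continuous_charFun
  have hcf' : Continuous (charFun ν) := continuous_charFun
  have key := integral_le_of_le_mul_of_le_rpow
    (F := fun t => ‖charFun (quicksortS^[n] μ) t - charFun ν t‖) (by fun_prop)
    -- The slope b is the contraction bound near 0; K = 2c adds the decay bounds of the two laws.
    (hi.sub hi').norm (fun t => ?_) (b := A * (2 / 3) ^ ((n : ℝ) / 2)) (K := 2 * c) (p := p)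
    (by positivity) (by positivity) hp (fun t ht => norm_charFun_iterate_sub_le hν h2 h0 n ht)
    (fun t ht => ?_)
  · refine (mul_le_mul_of_nonneg_left key (by positivity)).trans (le_of_eq ?_)
    set ρ := (2 / 3 : ℝ) ^ ((n : ℝ) / 2) with hρ
    have hρ0 : 0 < ρ := by positivity
    have e1 : (2 / 3 : ℝ) ^ ((1 / 2 - 1 / (p + 1)) * (n : ℝ)) = ρ * (ρ ^ (2 / (p + 1)))⁻¹ := by
      rw [hρ, ← Real.rpow_mul (by norm_num), ← Real.rpow_neg (by norm_num),
        ← Real.rpow_add (by norm_num)]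
      congr 1
      field_simp
      ring
    have e2 : (2 * c / (A * ρ)) ^ (2 / (p + 1)) =
        (2 * c / A) ^ (2 / (p + 1)) * (ρ ^ (2 / (p + 1)))⁻¹ := by
      rw [← div_div, Real.div_rpow (by positivity) hρ0.le, div_eq_mul_inv]
    rw [e1, e2]
    ring
  · rcases abs_choice t with h | h
    · rw [h]
    · rw [h, charFun_neg, charFun_neg, ← map_sub, RCLike.norm_conj]
  · refine (norm_sub_le _ _).trans ?_
    linarith [hd t ht, hd' t ht]

theorem UniformCharFunDecay.quicksortLaw {m : ℕ} (h : UniformCharFunDecay m p c)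
    (hν : IsQuicksortLaw ν) : HasCharFunDecay p c ν := by
  have := h ν hν.isProbabilityMeasure m le_rfl
  rwa [hν.iterate] at this

theorem abs_charFunDensity_iterate_sub_le_of_uniform {m : ℕ} (hν : IsQuicksortLaw ν)
    (h2 : MemLp (fun x : ℝ => x) 2 μ) (h0 : ∫ x, x ∂μ = 0) (hp : 1 < p) (hc : 0 < c)
    (hd : UniformCharFunDecay m p c) (hn : m ≤ n) (x : ℝ) :
    |charFunDensity (quicksortS^[n] μ) x - charFunDensity ν x| ≤
      quicksortA μ ν / (2 * Real.pi) * (2 * c / quicksortA μ ν) ^ (2 / (p + 1)) *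
        ((p + 1) / (p - 1)) * (2 / 3 : ℝ) ^ ((1 / 2 - 1 / (p + 1)) * (n : ℝ)) :=
  abs_charFunDensity_iterate_sub_le hν h2 h0 hp hc (hd μ inferInstance n hn) (hd.quicksortLaw hν) x

theorem abs_charFunDensity_iterate_sub_le_seven_half (hν : IsQuicksortLaw ν)
    (h2 : MemLp (fun x : ℝ => x) 2 μ) (h0 : ∫ x, x ∂μ = 0) (hn : 5 ≤ n) (x : ℝ) :
    |charFunDensity (quicksortS^[n] μ) x - charFunDensity ν x| ≤
      2297 * quicksortA μ ν * (2 / 3 : ℝ) ^ (5 * (n : ℝ) / 18) := by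
  have h := abs_charFunDensity_iterate_sub_le_of_uniform hν h2 h0 (by norm_num) (by norm_num)
    uniformCharFunDecay_seven_half hn x
  have hA := quicksortA_ge hν μ
  set A := quicksortA μ ν
  have hA0 : 0 < A := lt_of_lt_of_le (by norm_num) hA
  refine h.trans ?_
  rw [show (1 / 2 - 1 / (7 / 2 + 1)) * (n : ℝ) = 5 * (n : ℝ) / 18 by ring]
  refine mul_le_mul_of_nonneg_right ?_ (by positivity)
  have h3 : 2 * 132000000 / A ≤ 410000000 := by
    rw [div_le_iff₀ hA0]; linarith
  have h4 : (2 * 132000000 / A) ^ (2 / (7 / 2 + 1) : ℝ) ≤ 7500 := by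
    have := rpow_div_le_of_pow_le (x := 2 * 132000000 / A) (y := 7500) (k := 4) (m := 9)
      (by positivity) (by norm_num) (by norm_num)
      ((pow_le_pow_left₀ (by positivity) h3 4).trans (by norm_num))
    norm_num at this ⊢
    exact this
  have h5 : A / (2 * Real.pi) ≤ A / 6.28 := by
    have := Real.pi_gt_d2
    gcongr
    linarith
  have h6 := mul_le_mul h5 h4 (by positivity) (by positivity)
  have h7 : ((7 / 2 + 1) / (7 / 2 - 1) : ℝ) = 9 / 5 := by norm_num
  rw [h7]
  have h8 : A / 6.28 * 7500 * (9 / 5) ≤ 2297 * A := by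
    rw [div_mul_eq_mul_div, div_mul_eq_mul_div, div_le_iff₀ (by norm_num)]
    linarith
  linarith

theorem two_thirds_rpow_lt (hn : 5 ≤ n) :
    (2 / 3 : ℝ) ^ (5 * (n : ℝ) / 18) < (0.8935 : ℝ) ^ n := by
  rw [show 5 * (n : ℝ) / 18 = 5 / 18 * n by ring, Real.rpow_mul (by norm_num), Real.rpow_natCast]
  refine pow_lt_pow_left₀ ?_ (by positivity) (by omega)
  -- The 18th power reduces the comparison to (2/3)^5 < 0.8935^18.
  refine lt_of_pow_lt_pow_left₀ 18 (by norm_num) ?_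
  rw [← Real.rpow_natCast, ← Real.rpow_mul (by norm_num)]
  norm_num

/-- A poor rate, but valid from n = 3 on; it covers the small n that larger exponents p do not
reach. -/
theorem abs_charFunDensity_iterate_sub_le_three_half (hν : IsQuicksortLaw ν)
    (h2 : MemLp (fun x : ℝ => x) 2 μ) (h0 : ∫ x, x ∂μ = 0) (hn : 3 ≤ n) (x : ℝ) :
    |charFunDensity (quicksortS^[n] μ) x - charFunDensity ν x| ≤
      350 * quicksortA μ ν / Real.pi * (2 / 3 : ℝ) ^ ((n : ℝ) / 10) := by
  have h := abs_charFunDensity_iterate_sub_le_of_uniform hν h2 h0 (by norm_num) (by norm_num)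
    uniformCharFunDecay_three_half hn x
  have hA := quicksortA_ge hν μ
  set A := quicksortA μ ν
  have hA0 : 0 < A := lt_of_lt_of_le (by norm_num) hA
  refine h.trans ?_
  rw [show (1 / 2 - 1 / (3 / 2 + 1)) * (n : ℝ) = (n : ℝ) / 10 by ring]
  refine mul_le_mul_of_nonneg_right ?_ (by positivity)
  have h3 : 2 * 155 / A ≤ 479 := by
    rw [div_le_iff₀ hA0]; linarith
  have h4 : (2 * 155 / A) ^ (2 / (3 / 2 + 1) : ℝ) ≤ 140 := by
    have := rpow_div_le_of_pow_le (x := 2 * 155 / A) (y := 140) (k := 4) (m := 5)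
      (by positivity) (by norm_num) (by norm_num)
      ((pow_le_pow_left₀ (by positivity) h3 4).trans (by norm_num))
    norm_num at this ⊢
    exact this
  have h7 : ((3 / 2 + 1) / (3 / 2 - 1) : ℝ) = 5 := by norm_num
  rw [h7]
  have h8 := mul_le_mul_of_nonneg_left h4 (show 0 ≤ A / (2 * Real.pi) by positivity)
  have h9 : 350 * A / Real.pi = A / (2 * Real.pi) * 140 * 5 := by
    field_simp
    norm_num
  rw [h9]
  linarith

theorem abs_charFunDensity_iterate_sub_le_of_le (hν : IsQuicksortLaw ν)
    (h2 : MemLp (fun x : ℝ => x) 2 μ) (h0 : ∫ x, x ∂μ = 0) (hn : 3 ≤ n) (hn' : n ≤ 64) (x : ℝ) :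
    |charFunDensity (quicksortS^[n] μ) x - charFunDensity ν x| ≤
      128 * quicksortA μ ν / Real.pi * (2 / 3 : ℝ) ^ ((n : ℝ) / 2 - 3.7 * √(n : ℝ)) := by
  refine (abs_charFunDensity_iterate_sub_le_three_half hν h2 h0 hn x).trans ?_
  have hA := quicksortA_ge hν μ
  set A := quicksortA μ ν
  have hA0 : 0 < A := lt_of_lt_of_le (by norm_num) hA
  have hs : √(n : ℝ) ^ 2 = n := Real.sq_sqrt n.cast_nonneg
  have hs1 : 1 ≤ √(n : ℝ) := Real.one_le_sqrt.2 (by exact_mod_cast (show 1 ≤ n by omega))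
  have hs8 : √(n : ℝ) ≤ 8 := Real.sqrt_le_iff.2
    ⟨by norm_num, by norm_num; exact_mod_cast hn'⟩
  set s := √(n : ℝ)
  -- The difference 0.4s² - 3.7s + 3 is convex in s and negative at s = 1 and s = 8. The spare
  -- factor (3/2)³ = 27/8 raises 128 to 432, which exceeds 350.
  have h1 : (n : ℝ) / 2 - 3.7 * s ≤ n / 10 + (-3) := by nlinarith
  have h3 : (2 / 3 : ℝ) ^ ((n : ℝ) / 10 + (-3)) ≤ (2 / 3 : ℝ) ^ ((n : ℝ) / 2 - 3.7 * s) :=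
    Real.rpow_le_rpow_of_exponent_ge (by norm_num) (by norm_num) h1
  have h4 : (2 / 3 : ℝ) ^ ((n : ℝ) / 10 + (-3)) = (2 / 3 : ℝ) ^ ((n : ℝ) / 10) * (27 / 8) := by
    rw [Real.rpow_add (by norm_num)]
    norm_num
  rw [h4] at h3
  refine le_trans ?_ (mul_le_mul_of_nonneg_left h3 (by positivity))
  have h5 : 0 < A / Real.pi * (2 / 3 : ℝ) ^ ((n : ℝ) / 10) := by positivity
  have e1 : 350 * A / Real.pi * (2 / 3 : ℝ) ^ ((n : ℝ) / 10) =
    350 * (A / Real.pi * (2 / 3 : ℝ) ^ ((n : ℝ) / 10)) := by ring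
  have e2 : 128 * A / Real.pi * ((2 / 3 : ℝ) ^ ((n : ℝ) / 10) * (27 / 8)) =
    432 * (A / Real.pi * (2 / 3 : ℝ) ^ ((n : ℝ) / 10)) := by ring
  rw [e1, e2]
  linarith

/-- Equivalent to 2^84 ≤ 3^53; 84/53 is a convergent of log₂ 3. -/
theorem log_three_half_ge : 31 / 53 * Real.log 2 ≤ Real.log (3 / 2) := by
  have h : Real.log ((2 : ℝ) ^ 84) ≤ Real.log ((3 : ℝ) ^ 53) :=
    Real.log_le_log (by positivity) (by norm_num)
  rw [Real.log_pow, Real.log_pow] at h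
  rw [Real.log_div (by norm_num) (by norm_num)]
  push_cast at h
  linarith

/-- Here q = p + 1, s = √n, L = log 2 and M = log(3/2). The leading part 2Lq + Ms²/q is least at q =
s√(M/(2L)) ≈ 0.54s, where it equals 2√(2LM) s, just below 3.7Ms. The term 4q inside the bracket
produces 8L, that is, the factor 2⁸ = 256, which over 2π becomes 128/π. -/
theorem exponent_bound_of_near {q s L M : ℝ} (hs : 8 ≤ s) (hq1 : 0.54 * s - 1 / 2 ≤ q)
    (hq2 : q ≤ 0.54 * s + 1 / 2) (hL : 0.69 ≤ L) (hM : 31 / 53 * L ≤ M) :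
    2 / q * (L * (q ^ 2 + 4 * q - 4) + 1 / 2 - (2 * q - 3) / (2 * (q - 2))) + 2 / (q - 2) +
      M * (s ^ 2 / q) ≤ 8 * L + 3.7 * M * s := by
  have hq : 3.8 ≤ q := by linarith
  have hq0 : 0 < q := by linarith
  have hq2' : 0 < q - 2 := by linarith
  have h1 : 3 / (q - 2) ≤ 1.7 := by
    rw [div_le_iff₀ hq2']; linarith
  have h2 : 0 ≤ 3.7 * s * q - s ^ 2 := by nlinarith
  have h3 : 2 * q ^ 2 - 31 / 53 * (3.7 * s * q - s ^ 2) ≤ 0.6 := by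
    obtain ⟨d, rfl⟩ : ∃ d, q = 0.54 * s + d := ⟨q - 0.54 * s, by ring⟩
    have hd1 : -(1 / 2) ≤ d := by linarith
    have hd2 : d ≤ 1 / 2 := by linarith
    have hd : d ^ 2 ≤ 1 / 4 := by nlinarith
    have hsd : -(s / 2) ≤ s * d := by nlinarith
    nlinarith
  have h4 : M * (3.7 * s * q - s ^ 2) ≥ 31 / 53 * L * (3.7 * s * q - s ^ 2) :=
    mul_le_mul_of_nonneg_right hM h2
  have e : 2 / q * (L * (q ^ 2 + 4 * q - 4) + 1 / 2 - (2 * q - 3) / (2 * (q - 2))) + 2 / (q - 2) +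
      M * (s ^ 2 / q) - (8 * L + 3.7 * M * s) =
      (2 * L * q ^ 2 - 8 * L + 1 + 3 / (q - 2) - M * (3.7 * s * q - s ^ 2)) / q := by
    field_simp
    ring
  rw [← sub_nonpos, e]
  refine div_nonpos_of_nonpos_of_nonneg ?_ hq0.le
  nlinarith

theorem abs_charFunDensity_iterate_sub_le_of_ge (hν : IsQuicksortLaw ν)
    (h2 : MemLp (fun x : ℝ => x) 2 μ) (h0 : ∫ x, x ∂μ = 0) (hn : 64 ≤ n) (x : ℝ) :
    |charFunDensity (quicksortS^[n] μ) x - charFunDensity ν x| ≤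
      128 * quicksortA μ ν / Real.pi * (2 / 3 : ℝ) ^ ((n : ℝ) / 2 - 3.7 * √(n : ℝ)) := by
  have hn64 : (64 : ℝ) ≤ n := by exact_mod_cast hn
  have hs : √(n : ℝ) ^ 2 = n := Real.sq_sqrt n.cast_nonneg
  have hs8 : 8 ≤ √(n : ℝ) := Real.le_sqrt_of_sq_le (by norm_num; exact hn)
  set s := √(n : ℝ)
  -- The available exponents are p = k + 3/2; this choice puts q = p + 1 within 1/2 of the optimal
  -- 0.54√n.
  set k := ⌊0.54 * s - 2⌋₊ with hk
  have hk1 : (k : ℝ) ≤ 0.54 * s - 2 := Nat.floor_le (by linarith)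
  have hk2 : 0.54 * s - 2 < k + 1 := Nat.lt_floor_add_one _
  have hkn : k + 3 ≤ n := by
    have : ((k + 3 : ℕ) : ℝ) ≤ n := by push_cast; nlinarith
    exact_mod_cast this
  have hk0 : (0 : ℝ) ≤ k := k.cast_nonneg
  have h := abs_charFunDensity_iterate_sub_le_of_uniform hν h2 h0 (by linarith)
    (decayConst_pos _) (uniformCharFunDecay_decayConst k) hkn x
  have hA := quicksortA_ge hν μ
  set A := quicksortA μ ν
  have hA0 : 0 < A := lt_of_lt_of_le (by norm_num) hA
  refine h.trans ?_
  obtain ⟨q, hq⟩ : ∃ q : ℝ, q = k + 5 / 2 := ⟨_, rfl⟩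
  have hp : (k : ℝ) + 3 / 2 = q - 1 := by rw [hq]; ring
  rw [hp, sub_add_cancel, show q - 1 - 1 = q - 2 by ring]
  have hq1 : 0.54 * s - 1 / 2 ≤ q := by linarith
  have hq2 : q ≤ 0.54 * s + 1 / 2 := by linarith
  have hq0 : 0 < q := by linarith
  have hq20 : 0 < q - 2 := by linarith
  set L := Real.log 2 with hL
  set M := Real.log (3 / 2) with hM
  have hL69 : 0.69 ≤ L := by have := Real.log_two_gt_d9; linarith
  have key := exponent_bound_of_near hs8 hq1 hq2 hL69 log_three_half_ge
  have two_rpow : ∀ y : ℝ, (2 : ℝ) ^ y = Real.exp (L * y) := fun y =>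
    Real.rpow_def_of_pos zero_lt_two y
  have rho_rpow : ∀ y : ℝ, (2 / 3 : ℝ) ^ y = Real.exp (-(M * y)) := by
    intro y
    rw [Real.rpow_def_of_pos (by norm_num), show (2 / 3 : ℝ) = (3 / 2)⁻¹ by norm_num, Real.log_inv,
      neg_mul]
  have hinvA : 1 / A ≤ Real.exp (1 / 2) := by
    have := Real.quadratic_le_exp_of_nonneg (x := 1 / 2) (by norm_num)
    refine le_trans ?_ this
    rw [div_le_iff₀ hA0]
    norm_num
    linarith
  have hcA : 2 * decayConst (q - 1) / A ≤
      Real.exp (L * (q ^ 2 + 4 * q - 4) + 1 / 2 - (2 * q - 3) / (2 * (q - 2))) := by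
    have e : Real.exp (L * (q ^ 2 + 4 * q - 4) + 1 / 2 - (2 * q - 3) / (2 * (q - 2))) =
        2 * decayConst (q - 1) * Real.exp (1 / 2) := by
      rw [decayConst, two_rpow, ← Real.exp_log zero_lt_two, ← hL, ← Real.exp_add, ← Real.exp_add,
        ← Real.exp_add, Real.exp_log zero_lt_two]
      congr 1
      rw [show q - 1 - 1 = q - 2 by ring]
      ring
    rw [e, div_eq_mul_one_div]
    exact mul_le_mul_of_nonneg_left hinvA (mul_pos two_pos (decayConst_pos _)).le
  have hpow : (2 * decayConst (q - 1) / A) ^ (2 / q) ≤ Real.exp (2 / q *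
      (L * (q ^ 2 + 4 * q - 4) + 1 / 2 - (2 * q - 3) / (2 * (q - 2)))) := by
    rw [mul_comm (2 / q) (_ - _), Real.exp_mul]
    have := decayConst_pos (q - 1)
    exact Real.rpow_le_rpow (div_pos (mul_pos two_pos this) hA0).le hcA (div_pos two_pos hq0).le
  have hqq : q / (q - 2) ≤ Real.exp (2 / (q - 2)) := by
    refine le_trans (le_of_eq ?_) (Real.add_one_le_exp _)
    field_simp
    ring
  have hd := decayConst_pos (q - 1)
  calc A / (2 * Real.pi) * (2 * decayConst (q - 1) / A) ^ (2 / q) * (q / (q - 2)) *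
        (2 / 3) ^ ((1 / 2 - 1 / q) * (n : ℝ))
      ≤ A / (2 * Real.pi) * Real.exp (2 / q *
      (L * (q ^ 2 + 4 * q - 4) + 1 / 2 - (2 * q - 3) / (2 * (q - 2)))) *
        Real.exp (2 / (q - 2)) * Real.exp (-(M * ((1 / 2 - 1 / q) * (n : ℝ)))) := by
        rw [rho_rpow]
        gcongr
    _ = A / (2 * Real.pi) * Real.exp (2 / q *
      (L * (q ^ 2 + 4 * q - 4) + 1 / 2 - (2 * q - 3) / (2 * (q - 2))) + 2 / (q - 2) +
        -(M * ((1 / 2 - 1 / q) * (n : ℝ)))) := by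
        rw [Real.exp_add, Real.exp_add]; ring
    _ ≤ A / (2 * Real.pi) * Real.exp (L * 8 + -(M * ((n : ℝ) / 2 - 3.7 * s))) := by
        refine mul_le_mul_of_nonneg_left (Real.exp_le_exp.2 ?_) (by positivity)
        have : M * ((1 / 2 - 1 / q) * (n : ℝ)) = M * (n / 2) - M * (s ^ 2 / q) := by
          rw [hs]; ring
        rw [this]
        linarith
    _ = 128 * A / Real.pi * (2 / 3) ^ ((n : ℝ) / 2 - 3.7 * s) := by
        rw [rho_rpow, Real.exp_add, ← two_rpow]
        norm_num
        ring

/-- For fixed p the rate is (2/3)^(1/2 - 1/(p+1)), which falls below r once p is large. Only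
finitely many n ≤ p + 1 remain, and the bound for p = 3/2 handles them. -/
theorem exists_mul_pow_bound (hν : IsQuicksortLaw ν)
    (h2 : MemLp (fun x : ℝ => x) 2 μ) (h0 : ∫ x, x ∂μ = 0) {r : ℝ} (hr : √(2 / 3) < r) :
    ∃ C : ℝ, ∀ n : ℕ, 3 ≤ n → ∀ x : ℝ,
      |charFunDensity (quicksortS^[n] μ) x - charFunDensity ν x| ≤ C * r ^ n := by
  have hr0 : 0 < r := (Real.sqrt_nonneg _).trans_lt hr
  have hA : 0 < quicksortA μ ν := lt_of_lt_of_le (by norm_num) (quicksortA_ge hν μ)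
  obtain ⟨ε, hε0, hε2, hεr⟩ : ∃ ε : ℝ, 0 < ε ∧ ε < 1 / 2 ∧ (2 / 3 : ℝ) ^ (1 / 2 - ε) < r := by
    have hc : Continuous fun ε : ℝ => (2 / 3 : ℝ) ^ (1 / 2 - ε) :=
      Continuous.rpow continuous_const (by fun_prop) fun _ => Or.inl (by norm_num)
    have h3 : (2 / 3 : ℝ) ^ (1 / 2 - (0 : ℝ)) < r := by
      rwa [sub_zero, ← Real.sqrt_eq_rpow]
    have h4 : ∀ᶠ ε in nhdsWithin (0 : ℝ) (Set.Ioi 0), (2 / 3 : ℝ) ^ (1 / 2 - ε) < r :=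
      nhdsWithin_le_nhds (hc.continuousAt.eventually_lt continuousAt_const h3)
    obtain ⟨ε, h5, h6⟩ := (h4.and (Ioo_mem_nhdsGT (show (0 : ℝ) < 1 / 2 by norm_num))).exists
    exact ⟨ε, h6.1, h6.2, h5⟩
  set p := 1 / ε - 1 with hp
  have hpε : 1 / (p + 1) = ε := by rw [hp, sub_add_cancel, one_div_one_div]
  have hp1 : 1 < p := by
    have : 2 < 1 / ε := by rw [lt_div_iff₀ hε0]; linarith
    linarith
  obtain ⟨c, hc⟩ := exists_isCharFunConst hp1
  have hc0 := hc.1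
  have hp0 : 0 < p - 1 := by linarith
  set C1 := quicksortA μ ν / (2 * Real.pi) * (2 * c / quicksortA μ ν) ^ (2 / (p + 1)) *
        ((p + 1) / (p - 1)) with hC1
  have hC1nn : 0 ≤ C1 := by positivity
  set C0 := 350 * quicksortA μ ν / Real.pi with hC0
  have hC0nn : 0 ≤ C0 := by positivity
  set N := ⌈p + 1⌉₊ with hN
  set m := min r 1 with hm
  have hm0 : 0 < m := lt_min hr0 one_pos
  -- C1 serves n > p + 1. For n ≤ N, r^n ≥ m^N, so C0/m^N compensates for r^n; the minimum with 1 in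
  -- m allows for r > 1.
  refine ⟨C1 + C0 / m ^ N, fun n hn x => ?_⟩
  rw [add_mul]
  have hrn : 0 < r ^ n := by positivity
  rcases lt_or_ge (p + 1) n with hpn | hpn
  · have hνp : HasCharFunDecay p c ν := by
      have := hν.isProbabilityMeasure
      have h7 := IsCharFunConst.hasCharFunDecay hc ν hpn
      rwa [hν.iterate] at h7
    have h8 := abs_charFunDensity_iterate_sub_le hν h2 h0 hp1 hc0
      (IsCharFunConst.hasCharFunDecay hc μ hpn) hνp x
    rw [hpε, Real.rpow_mul (by norm_num), Real.rpow_natCast] at h8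
    refine h8.trans ?_
    have h9 : ((2 / 3 : ℝ) ^ (1 / 2 - ε)) ^ n ≤ r ^ n :=
      pow_le_pow_left₀ (by positivity) hεr.le n
    have h10 : 0 ≤ C0 / m ^ N * r ^ n := by positivity
    have := mul_le_mul_of_nonneg_left h9 hC1nn
    linarith
  · have h8 := abs_charFunDensity_iterate_sub_le_three_half hν h2 h0 hn x
    have h9 : (2 / 3 : ℝ) ^ ((n : ℝ) / 10) ≤ 1 :=
      Real.rpow_le_one (by norm_num) (by norm_num) (by positivity)
    have hnN : n ≤ N := by
      have : (n : ℝ) ≤ N := hpn.trans (Nat.le_ceil _)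
      exact_mod_cast this
    have h10 : m ^ N ≤ r ^ n :=
      (pow_le_pow_of_le_one hm0.le (min_le_right _ _) hnN).trans
        (pow_le_pow_left₀ hm0.le (min_le_left _ _) n)
    have h11 : C0 ≤ C0 / m ^ N * r ^ n := by
      rw [div_mul_eq_mul_div, le_div_iff₀ (by positivity)]
      exact mul_le_mul_of_nonneg_left h10 hC0nn
    have h12 : 0 ≤ C1 * r ^ n := by positivity
    have := mul_le_of_le_one_right hC0nn h9
    linarith

end Bounds

/-! ### The main theorem -/

theorem theorem3p2 :
    -- the law of `Y` exists, is unique, and has variance `σ² = 7 - 2π²/3`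
    ∃ ν : Measure ℝ, IsQuicksortLaw ν ∧ (∀ ν' : Measure ℝ, IsQuicksortLaw ν' → ν' = ν) ∧
      variance (fun x : ℝ => x) ν = 7 - 2 / 3 * Real.pi ^ 2 ∧
      -- the constants `c_p` exist
      (∀ p : ℝ, 1 < p → ∃ c : ℝ, IsCharFunConst p c) ∧
      -- `f` is the smooth density of `Y`
      ∃ f : ℝ → ℝ, IsBddContDensity ν f ∧ ContDiff ℝ ∞ f ∧
        ∀ μ : Measure ℝ, IsProbabilityMeasure μ → MemLp (fun x : ℝ => x) 2 μ →
          ∫ x, x ∂μ = 0 →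
          -- `fn n` is the density of `Z_n`
          ∃ fn : ℕ → ℝ → ℝ, (∀ n : ℕ, 3 ≤ n → IsBddContDensity (quicksortS^[n] μ) (fn n)) ∧
            (∀ r : ℝ, √(2 / 3) < r →
              ∃ C : ℝ, ∀ n : ℕ, 3 ≤ n → ∀ x : ℝ, |fn n x - f x| ≤ C * r ^ n) ∧
            (∀ p c : ℝ, 1 < p → IsCharFunConst p c →
              ∀ n : ℕ, p + 1 < (n : ℝ) → ∀ x : ℝ,
                |fn n x - f x| ≤
                  quicksortA μ ν / (2 * Real.pi) *
                    (2 * c / quicksortA μ ν) ^ (2 / (p + 1)) * ((p + 1) / (p - 1)) *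
                    (2 / 3 : ℝ) ^ ((1 / 2 - 1 / (p + 1)) * (n : ℝ))) ∧
            (∀ n : ℕ, 5 ≤ n →
              (∀ x : ℝ, |fn n x - f x| ≤
                2297 * quicksortA μ ν * (2 / 3 : ℝ) ^ (5 * (n : ℝ) / 18)) ∧
              2297 * quicksortA μ ν * (2 / 3 : ℝ) ^ (5 * (n : ℝ) / 18) <
                2297 * quicksortA μ ν * (0.8935 : ℝ) ^ n) ∧
            (∀ n : ℕ, 3 ≤ n → ∀ x : ℝ, |fn n x - f x| ≤
              128 * quicksortA μ ν / Real.pi *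
                (2 / 3 : ℝ) ^ ((n : ℝ) / 2 - 3.7 * √(n : ℝ))) := by
  obtain ⟨ν, hν⟩ := exists_isQuicksortLaw
  have hνP := hν.isProbabilityMeasure
  have hνi : Integrable (charFun ν) :=
    (uniformCharFunDecay_three_half.quicksortLaw hν).integrable (by norm_num) (by norm_num)
  refine ⟨ν, hν, fun ν' h' => hν.unique h', hν.variance_eq, fun p hp => exists_isCharFunConst hp,
    charFunDensity ν, isBddContDensity_charFunDensity hνi, ?_, ?_⟩
  · refine contDiff_charFunDensity fun k => ?_
    have hk : (0 : ℝ) ≤ k := k.cast_nonneg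
    obtain ⟨c, hc⟩ := exists_isCharFunConst (p := (k : ℝ) + 2) (by linarith)
    -- Since ν is fixed by S, any n beyond (k + 2) + 1 will do; decay of order k + 2 leaves t^(-2)
    -- after multiplication by |t|^k.
    have h := IsCharFunConst.hasCharFunDecay hc ν (n := k + 4) (by push_cast; linarith)
    rw [hν.iterate] at h
    exact h.integrable_pow_mul hc.1.le
  · intro μ hμ h2 h0
    refine ⟨fun n => charFunDensity (quicksortS^[n] μ), fun n hn => ?_,
      fun r hr => exists_mul_pow_bound hν h2 h0 hr, fun p c hp hc n hn x => ?_, fun n hn => ⟨fun x =>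
      abs_charFunDensity_iterate_sub_le_seven_half hν h2 h0 hn x, ?_⟩, fun n hn x => ?_⟩
    · exact isBddContDensity_charFunDensity
        ((uniformCharFunDecay_three_half μ hμ n hn).integrable (by norm_num) (by norm_num))
    · have hd := IsCharFunConst.hasCharFunDecay hc ν hn
      rw [hν.iterate] at hd
      exact abs_charFunDensity_iterate_sub_le hν h2 h0 hp hc.1
        (IsCharFunConst.hasCharFunDecay hc μ hn) hd x
    · have hA : 0 < quicksortA μ ν := lt_of_lt_of_le (by norm_num) (quicksortA_ge hν μ)
      exact mul_lt_mul_of_pos_left (two_thirds_rpow_lt hn) (by positivity)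
    · rcases le_total n 64 with h | h
      · exact abs_charFunDensity_iterate_sub_le_of_le hν h2 h0 hn h x
      · exact abs_charFunDensity_iterate_sub_le_of_ge hν h2 h0 h x
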